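/- Let $X=\{X_t\colon t\ge 0\}$ be a real Lévy process with $X_0=0$ on a probability space $(\Omega,\mathcal F,\mathbf P)$ with a complete filtration $(\mathcal F_t)_{t\ge 0}$ (that is, $X$ is adapted, its paths are almost surely right-continuous with left limits, and for all $s,h\ge 0$ the increment $X_{s+h}-X_s$ is independent of $\mathcal F_s$ and distributed as $X_h$). For $x\in\mathbb R$ let $\mathbf E_x$ denote expectation when $X$ is replaced by $x+X$. Let $r>0$, let $e_r$ be an exponential random variable of parameter $r$ independent of $X$, and put $$M=\sup\{X_t\colon 0\le t\le e_r\},\qquad I=\inf\{X_t\colon 0\le t\le e_r\}.$$ Let $g\colon\mathbb R\to[0,\infty)$ be continuous. Assume that there exist two points $-x_1<0<x_2$ and two continuous functions $Q_1,Q_2\colon\mathbb R\to\mathbb R$, where $Q_1$ is non-increasing with $Q_1(x)=0$ for $x\ge -x_1$ and $Q_2$ is non-decreasing with $Q_2(x)=0$ for $x\le x_2$, such that $$g(x)=\mathbf E_xQ_1(I)+\mathbf E_xQ_2(M)\qquad\text{for all }x\notin(-x_1,x_2).$$ Define $$V(x)=\mathbf E_x\bigl(Q_1(I)+Q_2(M)\bigr)\qquad\text{for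 all }x\in\mathbb R,$$ and assume that $V(x)\ge g(x)$ for all $x\in[-x_1,x_2]$. Then, for every $x\in\mathbb R$, $V(x)$ is finite and $$V(x)=\sup_{\tau\in\mathcal M}\mathbf E_x\bigl(e^{-r\tau}g(X_\tau)\mathbf 1_{\{\tau<\infty\}}\bigr)=\mathbf E_x\bigl(e^{-r\tau^*}g(X_{\tau^*})\mathbf 1_{\{\tau^*<\infty\}}\bigr),$$ where $\mathcal M$ is the set of all stopping times $\tau\colon\Omega\to[0,\infty]$ of $(\mathcal F_t)$, and where $\tau^*=\inf\{t\ge 0\colon X_t\notin(-x_1,x_2)\}$ (for the process departing from $x$, with $\inf\emptyset=\infty$) belongs to $\mathcal M$. Thus $V$ is the value function of the optimal stopping problem and $\tau^*$ is an optimal stopping time. -/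

import Mathlib

open MeasureTheory ProbabilityTheory Filter Topology
open scoped NNReal ENNReal

noncomputable section

namespace TwoSidedStopping

/-- A path on `[0, ∞)` that is right-continuous and has (finite) left limits. -/
def IsCadlag (f : ℝ≥0 → ℝ) : Prop :=
  ∀ t, ContinuousWithinAt f (Set.Ici t) t ∧ ∃ l, Tendsto f (𝓝[<] t) (𝓝 l)

/-- `X` is a real Lévy process, started at `0`, on the stochastic basis `(Ω, 𝓕, P)`. -/
structure IsLevyProcess {Ω : Type*} {mΩ : MeasurableSpace Ω} (P : Measure Ω)
    (𝓕 : Filtration ℝ≥0 mΩ) (X : ℝ≥0 → Ω → ℝ) : Prop where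
  adapted : ∀ t, Measurable[𝓕 t] (X t)
  start_zero : ∀ᵐ ω ∂P, X 0 ω = 0
  cadlag : ∀ᵐ ω ∂P, IsCadlag fun t => X t ω
  indep_increments : ∀ s h : ℝ≥0,
    Indep (MeasurableSpace.comap (fun ω => X (s + h) ω - X s ω) inferInstance) (𝓕 s) P
  stationary_increments : ∀ s h : ℝ≥0,
    IdentDistrib (fun ω => X (s + h) ω - X s ω) (fun ω => X h ω) P P

/-- The filtration is complete: every `P`-null set belongs to `𝓕 0` (hence to all `𝓕 t`). -/
def IsCompleteFiltration {Ω : Type*} {mΩ : MeasurableSpace Ω} (P : Measure Ω)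
    (𝓕 : Filtration ℝ≥0 mΩ) : Prop :=
  ∀ A : Set Ω, P A = 0 → MeasurableSet[𝓕 0] A

section

variable {Ω : Type*}

/-- The process `x + X` departing from `x`. -/
def startedAt (X : ℝ≥0 → Ω → ℝ) (x : ℝ) : ℝ≥0 → Ω → ℝ := fun t ω => x + X t ω

/-- `sup {Y_t : 0 ≤ t ≤ e}`, where the point of the sample space is the pair `(ω, e)`. -/
def runSup (Y : ℝ≥0 → Ω → ℝ) (p : Ω × ℝ) : ℝ :=
  sSup ((fun t : ℝ≥0 => Y t p.1) '' {t | (t : ℝ) ≤ p.2})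

/-- `inf {Y_t : 0 ≤ t ≤ e}`, where the point of the sample space is the pair `(ω, e)`. -/
def runInf (Y : ℝ≥0 → Ω → ℝ) (p : Ω × ℝ) : ℝ :=
  sInf ((fun t : ℝ≥0 => Y t p.1) '' {t | (t : ℝ) ≤ p.2})

variable {mΩ : MeasurableSpace Ω}

/-- Expectation of a non-negative random variable on `Ω × ℝ` under `P ⊗ Exp(r)`: the second
coordinate is an exponential time of parameter `r`, independent of everything on `Ω`. -/
def expectExp (P : Measure Ω) (r : ℝ) (Z : Ω × ℝ → ℝ) : ℝ≥0∞ :=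
  ∫⁻ p, ENNReal.ofReal (Z p) ∂(P.prod (expMeasure r))

/-- `E_x Q(I)`. -/
def expectInf (P : Measure Ω) (X : ℝ≥0 → Ω → ℝ) (r : ℝ) (Q : ℝ → ℝ) (x : ℝ) : ℝ≥0∞ :=
  expectExp P r fun p => Q (runInf (startedAt X x) p)

/-- `E_x Q(M)`. -/
def expectSup (P : Measure Ω) (X : ℝ≥0 → Ω → ℝ) (r : ℝ) (Q : ℝ → ℝ) (x : ℝ) : ℝ≥0∞ :=
  expectExp P r fun p => Q (runSup (startedAt X x) p)

/-- The function `V(x) = E_x (Q₁(I) + Q₂(M))`. -/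
def candidate (P : Measure Ω) (X : ℝ≥0 → Ω → ℝ) (r : ℝ) (Q₁ Q₂ : ℝ → ℝ) (x : ℝ) : ℝ≥0∞ :=
  expectExp P r fun p => Q₁ (runInf (startedAt X x) p) + Q₂ (runSup (startedAt X x) p)

open scoped Classical in
/-- The discounted payoff `e^{-rτ} g(Y_τ)`, equal to zero on `{τ = ∞}`. -/
def payoff (Y : ℝ≥0 → Ω → ℝ) (r : ℝ) (g : ℝ → ℝ) (τ : Ω → WithTop ℝ≥0) (ω : Ω) : ℝ :=
  if τ ω = ⊤ then 0
  else Real.exp (-r * ((τ ω).untopD 0 : ℝ≥0)) * g (Y ((τ ω).untopD 0) ω)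

/-- `E_x (e^{-rτ} g(X_τ))`. -/
def expectPayoff (P : Measure Ω) (X : ℝ≥0 → Ω → ℝ) (r : ℝ) (g : ℝ → ℝ) (x : ℝ)
    (τ : Ω → WithTop ℝ≥0) : ℝ≥0∞ :=
  ∫⁻ ω, ENNReal.ofReal (payoff (startedAt X x) r g τ ω) ∂P

/-- The value of the optimal stopping problem started at `x`: the supremum of the expected
discounted payoff over all stopping times with values in `[0, ∞]`. -/
def valueFunction (P : Measure Ω) (𝓕 : Filtration ℝ≥0 mΩ) (X : ℝ≥0 → Ω → ℝ) (r : ℝ)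
    (g : ℝ → ℝ) (x : ℝ) : ℝ≥0∞ :=
  ⨆ τ : {τ : Ω → WithTop ℝ≥0 // IsStoppingTime 𝓕 τ}, expectPayoff P X r g x τ.1

/-- `inf {t ≥ 0 : x + X_t ∉ (a, b)}`, with `inf ∅ = ∞`. -/
def exitTime (X : ℝ≥0 → Ω → ℝ) (x a b : ℝ) : Ω → WithTop ℝ≥0 :=
  hittingAfter (startedAt X x) (Set.Ioo a b)ᶜ 0

end

end TwoSidedStopping

end

/-!
# Two-sided optimal stopping for a Lévy process at an independent exponential horizon

Write `V(x) = E_x Q₁(I) + E_x Q₂(M)`. Two facts about the functional `E_x Q₁(I)` and a stopping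
time `τ` carry the proof; those about `E_x Q₂(M)` are the same facts for `-X` and `y ↦ Q₂(-y)`.

* By the strong Markov property at `τ` and the lack of memory of the exponential time `e`,
  the expectation of `e^{-rτ} v₁(X_τ)`, with `v₁(y) = E_y Q₁(I)`, is that of `Q₁(inf_{[τ, e]} X)`
  on `{τ ≤ e}`. As `Q₁` is non-negative and non-increasing, this is at most `E_x Q₁(I)`
  (`IsLevyProcess.setLIntegral_discounted_meanInf_le`). Since `g ≤ V` everywhere, no stopping time
  yields more than `V(x)`.
* If the path stays in `(-x₁, x₂)` before `τ`, the part of it before `τ` cannot bring the infimum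
  strictly below `-x₁`, and `Q₁` vanishes on `[-x₁, ∞)`. So `Q₁(inf_{[τ, e]} X) = Q₁(I)` on
  `{τ ≤ e}`, and `Q₁(I) = 0` on `{e < τ}`: the inequality is an equality
  (`IsLevyProcess.setLIntegral_discounted_meanInf_eq`). At the exit time `τ*` the path has left
  the interval, where `g = V`, and the payoff of `τ*` is `V(x)`.

The strong Markov property (`IsLevyProcess.strong_markov`) is first proved for times with countably
many values, where it follows from the independence of `𝓕 s` and the path after `s`, then for
bounded continuous functionals by dyadic approximation from above, and finally by truncation.

The filtration is complete but not assumed right-continuous, so that `τ*` being a stopping time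
(`IsLevyProcess.isStoppingTime_hittingAfter`) is not a formality. The event that `X` comes
arbitrarily close to the closed set `C` up to time `t` lies in `𝓕 t`, and it differs from `{τ* ≤ t}`
only by paths that approach `C` and jump away from their left limit in `C`. Such paths form a
null set: the increment of `X` over `[T, T + h]`, for an optional time `T`, is no more spread out
than `X h`, which tends to `0` with `h` (`IsLevyProcess.measure_approach_without_hitting`).
-/

noncomputable section

namespace TwoSidedStopping

/-! ### Paths, their running infima, and a measurable version of the infimum -/

section

/-- The infimum of the path `f` over `[0, u]`. As an infimum of reals it is `0` when `u < 0` or when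
`f` is unbounded below on `[0, u]`. -/
def pathInf (f : ℝ≥0 → ℝ) (u : ℝ) : ℝ := sInf (f '' {t | (t : ℝ) ≤ u})

/-- A right-continuous path that is bounded below on compact time intervals. Unlike `IsCadlag`, this
is all that the study of the running infimum needs. -/
structure IsRegularPath (f : ℝ≥0 → ℝ) : Prop where
  right_cont : ∀ t, ContinuousWithinAt f (Set.Ici t) t
  bddBelow : ∀ u : ℝ, BddBelow (f '' {t | (t : ℝ) ≤ u})

lemma IsCadlag.isRegularPath {f : ℝ≥0 → ℝ} (hf : IsCadlag f) : IsRegularPath f := by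
  refine ⟨fun t => (hf t).1, fun u => ?_⟩
  rcases lt_or_ge u 0 with hu | hu
  · have : {t : ℝ≥0 | (t : ℝ) ≤ u} = ∅ := by
      ext t
      simp only [Set.mem_ofPred_eq, Set.mem_empty_iff_false, iff_false, not_le]
      exact hu.trans_le t.coe_nonneg
    simp [this]
  lift u to ℝ≥0 using hu
  have hIcc : {t : ℝ≥0 | (t : ℝ) ≤ u} = Set.Icc 0 u := by ext t; simp
  rw [hIcc]
  refine isCompact_Icc.induction_on (p := fun s => BddBelow (f '' s)) (by simp)
    (fun s t hst ht => ht.mono (Set.image_mono hst))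
    (fun s t hs ht => by rw [Set.image_union]; exact hs.union ht) fun t _ => ?_
  obtain ⟨hr, l, hl⟩ := hf t
  have h1 : ∀ᶠ s in 𝓝[≥] t, f t - 1 < f s := hr.eventually_const_lt (by linarith)
  have h2 : ∀ᶠ s in 𝓝[<] t, l - 1 < f s := hl.eventually_const_lt (by linarith)
  have h3 : ∀ᶠ s in 𝓝 t, min (l - 1) (f t - 1) < f s := by
    rw [← nhdsLT_sup_nhdsGE, eventually_sup]
    exact ⟨h2.mono fun s hs => (min_le_left _ _).trans_lt hs,
      h1.mono fun s hs => (min_le_right _ _).trans_lt hs⟩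
  refine ⟨_, mem_nhdsWithin_of_mem_nhds h3, min (l - 1) (f t - 1), ?_⟩
  rintro _ ⟨s, hs, rfl⟩
  exact le_of_lt hs

lemma IsCadlag.neg {f : ℝ≥0 → ℝ} (hf : IsCadlag f) : IsCadlag fun t => -f t := fun t =>
  ⟨(hf t).1.neg, let ⟨l, hl⟩ := (hf t).2; ⟨-l, hl.neg⟩⟩

namespace IsRegularPath

variable {f : ℝ≥0 → ℝ}

lemma comp_add (hf : IsRegularPath f) (s : ℝ≥0) : IsRegularPath fun h => f (s + h) := by
  refine ⟨fun t => ?_, fun u => (hf.bddBelow (s + u)).mono ?_⟩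
  · refine ContinuousWithinAt.comp (t := Set.Ici (s + t)) (hf.right_cont (s + t))
      (by fun_prop) fun h hh => ?_
    exact add_le_add_right hh s
  · rintro _ ⟨t, ht, rfl⟩
    exact ⟨s + t, by simpa using ht, rfl⟩

lemma add_const (hf : IsRegularPath f) (c : ℝ) : IsRegularPath fun h => f h + c := by
  refine ⟨fun t => (hf.right_cont t).add_const c, fun u => ?_⟩
  obtain ⟨b, hb⟩ := hf.bddBelow u
  refine ⟨b + c, ?_⟩
  rintro _ ⟨t, ht, rfl⟩
  have := hb ⟨t, ht, rfl⟩
  simpa using this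

lemma pathInf_le (hf : IsRegularPath f) {u : ℝ} {t : ℝ≥0} (ht : (t : ℝ) ≤ u) :
    pathInf f u ≤ f t := csInf_le (hf.bddBelow u) ⟨t, ht, rfl⟩

end IsRegularPath

lemma le_pathInf {f : ℝ≥0 → ℝ} {u c : ℝ} (hu : 0 ≤ u) (h : ∀ t : ℝ≥0, (t : ℝ) ≤ u → c ≤ f t) :
    c ≤ pathInf f u := by
  refine le_csInf ⟨f 0, 0, by simpa using hu, rfl⟩ ?_
  rintro _ ⟨t, ht, rfl⟩
  exact h t ht

lemma exists_lt_of_pathInf_lt {f : ℝ≥0 → ℝ} {u c : ℝ} (hu : 0 ≤ u) (h : pathInf f u < c) :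
    ∃ t : ℝ≥0, (t : ℝ) ≤ u ∧ f t < c := by
  by_contra! hc
  exact absurd (le_pathInf hu hc) (not_le.2 h)

lemma IsRegularPath.pathInf_add_const {f : ℝ≥0 → ℝ} (hf : IsRegularPath f) (c : ℝ) {u : ℝ}
    (hu : 0 ≤ u) : pathInf (fun h => f h + c) u = pathInf f u + c := by
  refine le_antisymm ?_ (le_pathInf hu fun t ht => by linarith [hf.pathInf_le ht])
  rw [← sub_le_iff_le_add]
  exact le_pathInf hu fun t ht => by linarith [(hf.add_const c).pathInf_le ht]

/-- The infimum over `[0, u]` of a path known at rational times only: the limit as `n → ∞` of the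
infima over the rationals below `u + 1 / (n + 1)`. Excluded rationals contribute the value at `0`,
which does not change the infimum and keeps the family bounded. Only countably many coordinates
enter, so that `ratInf` is jointly measurable (`measurable_ratInf`), and for regular paths it is
`pathInf` (`IsRegularPath.ratInf_eq`). -/
def ratInf (z : ℚ≥0 → ℝ) (u : ℝ) : ℝ :=
  ⨆ n : ℕ, ⨅ q : ℚ≥0, if ((q : ℝ≥0) : ℝ) < u + 1 / ((n : ℝ) + 1) then z q else z 0

lemma measurable_ratInf {E : Type*} [MeasurableSpace E] {z : E → ℚ≥0 → ℝ} {u : E → ℝ}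
    (hz : Measurable z) (hu : Measurable u) : Measurable fun p => ratInf (z p) (u p) := by
  refine Measurable.iSup fun n => Measurable.iInf fun q => Measurable.ite ?_ ?_ ?_
  · exact measurableSet_lt measurable_const (by fun_prop)
  · fun_prop
  · fun_prop

lemma exists_nnrat_btwn {s t : ℝ≥0} (h : s < t) : ∃ q : ℚ≥0, s < (q : ℝ≥0) ∧ (q : ℝ≥0) < t := by
  obtain ⟨q, h1, h2⟩ := exists_rat_btwn (NNReal.coe_lt_coe.2 h)
  have hq : 0 ≤ q := by
    have : (0 : ℝ) ≤ q := s.coe_nonneg.trans h1.le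
    exact_mod_cast this
  lift q to ℚ≥0 using hq
  refine ⟨q, ?_, ?_⟩
  · rw [← NNReal.coe_lt_coe]; exact_mod_cast h1
  · rw [← NNReal.coe_lt_coe]; exact_mod_cast h2

lemma exists_nnrat_of_right_cont {f : ℝ≥0 → ℝ} {s t : ℝ≥0}
    (hf : ContinuousWithinAt f (Set.Ici s) s) (hst : s < t) {U : Set ℝ} (hU : IsOpen U)
    (hs : f s ∈ U) : ∃ q : ℚ≥0, s < (q : ℝ≥0) ∧ (q : ℝ≥0) < t ∧ f q ∈ U := by
  have h1 : ∀ᶠ r in 𝓝[≥] s, f r ∈ U := hf (hU.mem_nhds hs)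
  obtain ⟨r, hr, hr'⟩ := mem_nhdsGE_iff_exists_Ico_subset.1 h1
  obtain ⟨q, hq1, hq2⟩ := exists_nnrat_btwn (lt_min hr hst)
  exact ⟨q, hq1, hq2.trans_le (min_le_right _ _),
    hr' ⟨hq1.le, hq2.trans_le (min_le_left _ _)⟩⟩

lemma IsRegularPath.ratInf_eq {f : ℝ≥0 → ℝ} (hf : IsRegularPath f) {u : ℝ} (hu : 0 ≤ u) :
    ratInf (fun q => f q) u = pathInf f u := by
  lift u to ℝ≥0 using hu
  have hpos : ∀ n : ℕ, (0 : ℝ) < 1 / ((n : ℝ) + 1) := fun n => by positivity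
  have hbdd : ∀ n : ℕ, BddBelow (Set.range fun q : ℚ≥0 =>
      if ((q : ℝ≥0) : ℝ) < u + 1 / ((n : ℝ) + 1) then f q else f (0 : ℚ≥0)) := by
    intro n
    refine ⟨pathInf f (u + 1 / ((n : ℝ) + 1)), ?_⟩
    rintro _ ⟨q, rfl⟩
    dsimp only
    have := hpos n
    split_ifs with h
    · exact hf.pathInf_le h.le
    · exact hf.pathInf_le (by simp only [NNRat.cast_zero, NNReal.coe_zero]; positivity)
  have hle : ∀ n : ℕ, (⨅ q : ℚ≥0,
      if ((q : ℝ≥0) : ℝ) < u + 1 / ((n : ℝ) + 1) then f q else f (0 : ℚ≥0)) ≤ pathInf f u := by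
    intro n
    refine le_pathInf u.coe_nonneg fun t ht => le_of_forall_pos_lt_add fun ε hε => ?_
    have hlt : t < u + 1 / ((n : ℝ≥0) + 1) :=
      lt_of_le_of_lt (NNReal.coe_le_coe.1 ht) (lt_add_of_pos_right _ (by positivity))
    obtain ⟨q, -, hq2, hq3⟩ := exists_nnrat_of_right_cont (hf.right_cont t) hlt
      (isOpen_Iio (a := f t + ε)) (by simpa using hε)
    have hq2' : ((q : ℝ≥0) : ℝ) < u + 1 / ((n : ℝ) + 1) := by
      have := NNReal.coe_lt_coe.2 hq2
      push_cast at this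
      exact_mod_cast this
    refine (ciInf_le (hbdd n) q).trans_lt ?_
    rw [if_pos hq2']
    exact hq3
  refine le_antisymm (ciSup_le hle) (le_of_forall_sub_le fun ε hε => ?_)
  have h1 : ∀ᶠ r in 𝓝[≥] u, f u - ε < f r :=
    (hf.right_cont u).eventually_const_lt (by linarith)
  obtain ⟨r, hr, hr'⟩ := mem_nhdsGE_iff_exists_Ico_subset.1 h1
  have hr2 : (u : ℝ) < r := NNReal.coe_lt_coe.2 hr
  obtain ⟨n, hn⟩ := exists_nat_one_div_lt (sub_pos.2 hr2)
  have hsup : BddAbove (Set.range fun n : ℕ => ⨅ q : ℚ≥0,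
      if ((q : ℝ≥0) : ℝ) < u + 1 / ((n : ℝ) + 1) then f q else f (0 : ℚ≥0)) :=
    ⟨pathInf f u, by rintro _ ⟨n, rfl⟩; exact hle n⟩
  refine le_trans (le_ciInf fun q => ?_) (le_ciSup hsup n)
  split_ifs with h
  · rcases le_or_gt (q : ℝ≥0) u with hq | hq
    · have := hf.pathInf_le (NNReal.coe_le_coe.2 hq)
      linarith
    · have h3 : f u - ε < f q := hr' ⟨hq.le, by rw [← NNReal.coe_lt_coe]; linarith⟩
      have := hf.pathInf_le (le_refl (u : ℝ))
      linarith
  · have := hf.pathInf_le (t := ((0 : ℚ≥0) : ℝ≥0)) (u := u) (by simp)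
    linarith

/-- The infimum over `[s, s + v]` is right-continuous in `s`. -/
lemma IsRegularPath.tendsto_pathInf_shift {f : ℝ≥0 → ℝ} (hf : IsRegularPath f) {s : ℝ≥0}
    {S : ℕ → ℝ≥0} (hS : ∀ m, s ≤ S m) (hlim : Tendsto S atTop (𝓝 s)) {v : ℝ} (hv : 0 ≤ v) :
    Tendsto (fun m => pathInf (fun h => f (S m + h)) v) atTop
      (𝓝 (pathInf (fun h => f (s + h)) v)) := by
  lift v to ℝ≥0 using hv
  have hlim' : Tendsto S atTop (𝓝[≥] s) :=
    tendsto_nhdsWithin_iff.2 ⟨hlim, Eventually.of_forall hS⟩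
  refine tendsto_order.2 ⟨fun c hc => ?_, fun c hc => ?_⟩
  · obtain ⟨c', hc1, hc2⟩ := exists_between hc
    have hend : c' < f (s + v) := hc2.trans_le ((hf.comp_add s).pathInf_le (le_refl (v : ℝ)))
    have h1 : ∀ᶠ r in 𝓝[≥] (s + v), c' < f r := (hf.right_cont _).eventually_const_lt hend
    obtain ⟨r, hr, hr'⟩ := mem_nhdsGE_iff_exists_Ico_subset.1 h1
    have h2 : ∀ᶠ m in atTop, S m + v < r := (hlim.add_const _).eventually_lt_const hr
    filter_upwards [h2] with m hm
    refine hc1.trans_le (le_pathInf v.coe_nonneg fun t ht => ?_)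
    rw [NNReal.coe_le_coe] at ht
    rcases le_or_gt (S m + t) (s + v) with h | h
    · have h3 : S m + t = s + (S m + t - s) :=
        (add_tsub_cancel_of_le ((hS m).trans le_self_add)).symm
      rw [h3] at h ⊢
      exact hc2.le.trans ((hf.comp_add s).pathInf_le
        (NNReal.coe_le_coe.2 (le_of_add_le_add_left h)))
    · exact le_of_lt (hr' ⟨h.le, lt_of_le_of_lt (add_le_add_right ht _) hm⟩)
  · obtain ⟨t, ht, htc⟩ := exists_lt_of_pathInf_lt v.coe_nonneg hc
    rw [NNReal.coe_le_coe] at ht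
    rcases eq_or_lt_of_le (zero_le (a := t)) with rfl | h0
    · rw [add_zero] at htc
      have h1 : ∀ᶠ m in atTop, f (S m) < c :=
        ((hf.right_cont s).tendsto.comp hlim').eventually_lt_const htc
      filter_upwards [h1] with m hm
      refine lt_of_le_of_lt ((hf.comp_add (S m)).pathInf_le (t := 0) (u := v) (by simp)) ?_
      simpa using hm
    · have h1 : ∀ᶠ m in atTop, S m < s + t := hlim.eventually_lt_const (by simpa using h0)
      filter_upwards [h1] with m hm
      have h3 : s + t = S m + (s + t - S m) := (add_tsub_cancel_of_le hm.le).symm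
      rw [h3] at htc
      refine lt_of_le_of_lt ((hf.comp_add (S m)).pathInf_le (t := s + t - S m) (u := v) ?_) htc
      rw [NNReal.coe_le_coe, tsub_le_iff_left]
      exact add_le_add (hS m) ht

end

/-! ### The Markov property of the path after a fixed time -/

section

lemma measurable_indicator_one {Ω : Type*} {m : MeasurableSpace Ω} {A : Set Ω}
    (hA : MeasurableSet A) : Measurable (A.indicator (1 : Ω → ℝ≥0∞)) :=
  measurable_one.indicator hA

/-- Integration of a functional of an `m`-measurable `W` and a variable `Z` independent of `m`:
`W` may be frozen while `Z` is integrated out. -/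
lemma lintegral_of_indep {Ω E E' : Type*} {m mΩ : MeasurableSpace Ω}
    {mE : MeasurableSpace E} {mE' : MeasurableSpace E'} {P : Measure Ω} [IsProbabilityMeasure P]
    (hm : m ≤ mΩ) {Z : Ω → E} (hZ : Measurable Z) (hind : Indep (mE.comap Z) m P)
    {W : Ω → E'} (hW : Measurable[m] W) {k : E' × E → ℝ≥0∞} (hk : Measurable k) :
    ∫⁻ ω, k (W ω, Z ω) ∂P = ∫⁻ ω, ∫⁻ z, k (W ω, z) ∂(P.map Z) ∂P := by
  have hW' : Measurable W := hW.mono hm le_rfl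
  have hWZ : IndepFun W Z P :=
    indep_of_indep_of_le_left hind.symm (measurable_iff_comap_le.1 hW)
  have hmap := (indepFun_iff_map_prod_eq_prod_map_map hW'.aemeasurable hZ.aemeasurable).1 hWZ
  have : IsProbabilityMeasure (P.map Z) := Measure.isProbabilityMeasure_map hZ.aemeasurable
  rw [← lintegral_map (f := k) hk (hW'.prodMk hZ), hmap, lintegral_prod _ hk.aemeasurable,
    lintegral_map (hk.lintegral_prod_right' (ν := P.map Z)) hW']

variable {Ω : Type*} {mΩ : MeasurableSpace Ω} {P : Measure Ω}
  {𝓕 : Filtration ℝ≥0 mΩ} {X : ℝ≥0 → Ω → ℝ}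

/-- The path after time `s`, recentred at `X s` and restricted to rational times; by
right-continuity nothing is lost, and the path space becomes a countable product. -/
def postPath (X : ℝ≥0 → Ω → ℝ) (s : ℝ≥0) (ω : Ω) (q : ℚ≥0) : ℝ := X (s + q) ω - X s ω

/-- The law of the recentred path of `X` on rational times. -/
def pathLaw (P : Measure Ω) (X : ℝ≥0 → Ω → ℝ) : Measure (ℚ≥0 → ℝ) := P.map (postPath X 0)

namespace IsLevyProcess

lemma measurable (hX : IsLevyProcess P 𝓕 X) (t : ℝ≥0) : Measurable (X t) :=
  (hX.adapted t).mono (𝓕.le t) le_rfl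

lemma measurable_of_le (hX : IsLevyProcess P 𝓕 X) {s t : ℝ≥0} (h : s ≤ t) :
    Measurable[𝓕 t] (X s) := (hX.adapted s).mono (𝓕.mono h) le_rfl

lemma measurable_postPath (hX : IsLevyProcess P 𝓕 X) (s : ℝ≥0) : Measurable (postPath X s) :=
  measurable_pi_iff.2 fun _ => (hX.measurable _).sub (hX.measurable _)

variable [IsProbabilityMeasure P]

/-- Finite-dimensional form of the Markov property: the conditional probability, given `𝓕 s`, that
the process restarted from `W` at time `s` is in `B i` at each time `s + i`, `i ∈ I`, is `G W` for a
function `G` that does not depend on `s`. Proved by splitting off the smallest time of `I`. -/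
lemma exists_markov_functional (hX : IsLevyProcess P 𝓕 X) (n : ℕ) :
    ∀ (I : Finset ℚ≥0), I.card = n → ∀ B : ℚ≥0 → Set ℝ, (∀ i, MeasurableSet (B i)) →
      ∃ G : ℝ → ℝ≥0∞, Measurable G ∧ ∀ (s : ℝ≥0) (a : Ω → ℝ≥0∞) (W : Ω → ℝ),
        Measurable[𝓕 s] a → Measurable[𝓕 s] W →
        ∫⁻ ω, a ω * ∏ i ∈ I, (B i).indicator 1 (W ω + (X (s + i) ω - X s ω)) ∂P =
          ∫⁻ ω, a ω * G (W ω) ∂P := by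
  induction n with
  | zero =>
    intro I hI B hB
    obtain rfl := Finset.card_eq_zero.1 hI
    exact ⟨fun _ => 1, measurable_const, fun s a W _ _ => by simp⟩
  | succ n ih =>
    intro I hI B hB
    have hne : I.Nonempty := Finset.card_pos.1 (by omega)
    set i₀ := I.min' hne with hi₀
    have hmem : i₀ ∈ I := I.min'_mem hne
    have hle : ∀ i ∈ I.erase i₀, i₀ ≤ i := fun i hi => I.min'_le i (Finset.mem_of_mem_erase hi)
    have hinj : Set.InjOn (fun i => i - i₀) (I.erase i₀ : Finset ℚ≥0) := by
      intro i hi j hj hij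
      have h := congrArg (fun x => i₀ + x) hij
      simpa [add_tsub_cancel_of_le (hle i hi), add_tsub_cancel_of_le (hle j hj)] using h
    obtain ⟨G, hG, hG'⟩ := ih ((I.erase i₀).image fun i => i - i₀)
      (by rw [Finset.card_image_of_injOn hinj, Finset.card_erase_of_mem hmem, hI]; rfl)
      (fun j => B (i₀ + j)) (fun j => hB _)
    have h1B : Measurable ((B i₀).indicator (1 : ℝ → ℝ≥0∞)) := measurable_indicator_one (hB i₀)
    have hpr : IsProbabilityMeasure (P.map (X i₀)) :=
      Measure.isProbabilityMeasure_map (hX.measurable _).aemeasurable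
    refine ⟨fun y => ∫⁻ z, (B i₀).indicator 1 (y + z) * G (y + z) ∂(P.map (X i₀)), ?_, ?_⟩
    · exact Measurable.lintegral_prod_right' (ν := P.map (X i₀))
        (f := fun p : ℝ × ℝ => (B i₀).indicator 1 (p.1 + p.2) * G (p.1 + p.2))
        ((h1B.comp (by fun_prop)).mul (hG.comp (by fun_prop)))
    intro s a W ha hW
    -- The process restarted from `W` at time `s` is at `W'` at time `s + i₀`.
    set W' : Ω → ℝ := fun ω => W ω + (X (s + i₀) ω - X s ω) with hW'def
    have hs : s ≤ s + i₀ := le_self_add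
    have hW' : Measurable[𝓕 (s + i₀)] W' :=
      (hW.mono (𝓕.mono hs) le_rfl).add ((hX.adapted _).sub (hX.measurable_of_le hs))
    have ha' : Measurable[𝓕 (s + i₀)] fun ω => a ω * (B i₀).indicator 1 (W' ω) :=
      (ha.mono (𝓕.mono hs) le_rfl).mul (h1B.comp hW')
    have key := hG' (s + i₀) _ W' ha' hW'
    have hlhs : ∀ ω, a ω * ∏ i ∈ I, (B i).indicator 1 (W ω + (X (s + i) ω - X s ω)) =
        a ω * (B i₀).indicator 1 (W' ω) *
          ∏ j ∈ (I.erase i₀).image fun i => i - i₀, (B (i₀ + j)).indicator 1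
            (W' ω + (X (s + i₀ + j) ω - X (s + i₀) ω)) := by
      intro ω
      rw [Finset.prod_image hinj, ← Finset.mul_prod_erase I _ hmem, mul_assoc]
      congr 2
      refine Finset.prod_congr rfl fun i hi => ?_
      have e1 : i₀ + (i - i₀) = i := add_tsub_cancel_of_le (hle i hi)
      have e2 : s + (i₀ : ℝ≥0) + ((i - i₀ : ℚ≥0) : ℝ≥0) = s + i := by
        rw [add_assoc, ← NNRat.cast_add, e1]
      rw [e1, e2, hW'def]
      congr 1
      ring
    simp_rw [hlhs]
    rw [key]
    have hlaw : P.map (fun ω => X (s + i₀) ω - X s ω) = P.map (X i₀) :=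
      (hX.stationary_increments s i₀).map_eq
    have := lintegral_of_indep (𝓕.le s)
      ((hX.measurable (s + i₀)).sub (hX.measurable s)) (hX.indep_increments s i₀)
      (W := fun ω => (a ω, W ω)) (ha.prodMk hW)
      (k := fun p : (ℝ≥0∞ × ℝ) × ℝ =>
        p.1.1 * ((B i₀).indicator 1 (p.1.2 + p.2) * G (p.1.2 + p.2)))
      ((measurable_fst.comp measurable_fst).mul
        ((h1B.comp (by fun_prop)).mul (hG.comp (by fun_prop))))
    simp only [Pi.sub_apply] at this
    erw [hlaw] at this
    simp_rw [mul_assoc]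
    refine this.trans (lintegral_congr fun ω => ?_)
    rw [lintegral_const_mul]
    exact (h1B.comp (by fun_prop)).mul (hG.comp (by fun_prop))

lemma map_restrict_postPath (hX : IsLevyProcess P 𝓕 X) (s : ℝ≥0) {A : Set Ω}
    (hA : MeasurableSet[𝓕 s] A) :
    (P.restrict A).map (postPath X s) = P A • pathLaw P X := by
  have hA' : MeasurableSet A := 𝓕.le s _ hA
  have hcyl : ∀ (t : ℝ≥0) (A : Set Ω) (I : Finset ℚ≥0) (B : ℚ≥0 → Set ℝ),
      MeasurableSet[𝓕 t] A → (∀ i, MeasurableSet (B i)) →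
      (P.restrict A).map (postPath X t) ((I : Set ℚ≥0).pi B) =
      ∫⁻ ω, A.indicator 1 ω * ∏ i ∈ I, (B i).indicator 1 (0 + (X (t + i) ω - X t ω)) ∂P := by
    intro t A I B hA hB
    have hA' : MeasurableSet A := 𝓕.le t _ hA
    have hpi : MeasurableSet ((I : Set ℚ≥0).pi B) :=
      MeasurableSet.pi I.countable_toSet fun i _ => hB i
    rw [Measure.map_apply (hX.measurable_postPath t) hpi,
      Measure.restrict_apply (hX.measurable_postPath t hpi),
      ← lintegral_indicator_one ((hX.measurable_postPath t hpi).inter hA')]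
    refine lintegral_congr fun ω => ?_
    rw [Set.inter_indicator_one, Pi.mul_apply, mul_comm]
    congr 1
    simp only [zero_add]
    classical
    by_cases h : postPath X t ω ∈ (I : Set ℚ≥0).pi B
    · rw [Set.indicator_of_mem (show ω ∈ postPath X t ⁻¹' (I : Set ℚ≥0).pi B from h)]
      refine (Finset.prod_eq_one fun i hi => ?_).symm
      exact Set.indicator_of_mem (h i hi) _
    · rw [Set.indicator_of_notMem (show ω ∉ postPath X t ⁻¹' (I : Set ℚ≥0).pi B from h)]
      simp only [Set.mem_pi, not_forall] at h
      obtain ⟨i, hi, hi'⟩ := h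
      exact (Finset.prod_eq_zero hi (Set.indicator_of_notMem hi' _)).symm
  have h0 : (P.restrict Set.univ).map (postPath X 0) = pathLaw P X := by
    rw [Measure.restrict_univ]; rfl
  have hpr : IsProbabilityMeasure (pathLaw P X) :=
    Measure.isProbabilityMeasure_map (hX.measurable_postPath 0).aemeasurable
  refine ext_of_generate_finite _ generateFrom_squareCylinders.symm
    (isPiSystem_squareCylinders (fun _ => MeasurableSpace.isPiSystem_measurableSet)
      fun _ => (MeasurableSet.univ : MeasurableSet (Set.univ : Set ℝ))) ?_ ?_
  · rintro _ ⟨I, B, hB, rfl⟩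
    have hB' : ∀ i, MeasurableSet (B i) := fun i => hB i (Set.mem_univ i)
    obtain ⟨G, hG, hG'⟩ := hX.exists_markov_functional I.card I rfl B hB'
    rw [hcyl s A I B hA hB', Measure.smul_apply, ← h0, hcyl 0 _ I B MeasurableSet.univ hB',
      hG' s _ (fun _ => 0) (measurable_indicator_one hA) measurable_const,
      hG' 0 _ (fun _ => 0) (measurable_indicator_one MeasurableSet.univ) measurable_const]
    simp [lintegral_mul_const _ (measurable_indicator_one hA'), lintegral_indicator_one hA']
  · rw [Measure.map_apply (hX.measurable_postPath s) MeasurableSet.univ]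
    simp

lemma map_postPath (hX : IsLevyProcess P 𝓕 X) (s : ℝ≥0) :
    P.map (postPath X s) = pathLaw P X := by
  simpa using hX.map_restrict_postPath s MeasurableSet.univ

lemma isProbabilityMeasure_pathLaw (hX : IsLevyProcess P 𝓕 X) :
    IsProbabilityMeasure (pathLaw P X) :=
  Measure.isProbabilityMeasure_map (hX.measurable_postPath 0).aemeasurable

lemma indep_postPath (hX : IsLevyProcess P 𝓕 X) (s : ℝ≥0) :
    Indep (MeasurableSpace.comap (postPath X s) inferInstance) (𝓕 s) P := by
  refine (Indep_iff _ _ P).2 ?_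
  rintro _ A ⟨T, hT, rfl⟩ hA
  have h1 := congrArg (fun ν => ν T) (hX.map_restrict_postPath s hA)
  have h2 := congrArg (fun ν => ν T) (hX.map_postPath s)
  simp only [Measure.map_apply (hX.measurable_postPath s) hT, Measure.smul_apply,
    Measure.restrict_apply (hX.measurable_postPath s hT), smul_eq_mul] at h1 h2
  rw [h1, h2, mul_comm]

/-- Strong Markov property at a random time `c ∘ K` with countably many values: conditionally on the
past, the path after this time has the law `pathLaw P X`. -/
lemma setLIntegral_postPath (hX : IsLevyProcess P 𝓕 X) {A : Set Ω} {K : Ω → ℕ} {c : ℕ → ℝ≥0}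
    (hK : ∀ k, MeasurableSet[𝓕 (c k)] (A ∩ K ⁻¹' {k}))
    {H : ℕ → ℝ × (ℚ≥0 → ℝ) → ℝ≥0∞} (hH : ∀ k, Measurable (H k)) :
    ∫⁻ ω in A, H (K ω) (X (c (K ω)) ω, postPath X (c (K ω)) ω) ∂P =
      ∫⁻ ω in A, ∫⁻ z, H (K ω) (X (c (K ω)) ω, z) ∂(pathLaw P X) ∂P := by
  have hpr := hX.isProbabilityMeasure_pathLaw
  have hA : A = ⋃ k, A ∩ K ⁻¹' {k} := by
    rw [← Set.inter_iUnion, ← Set.preimage_iUnion, Set.iUnion_of_singleton, Set.preimage_univ,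
      Set.inter_univ]
  have hK' : ∀ k, MeasurableSet (A ∩ K ⁻¹' {k}) := fun k => 𝓕.le _ _ (hK k)
  have hd : Pairwise (Function.onFun Disjoint fun k => A ∩ K ⁻¹' {k}) := by
    intro i j hij
    refine Set.disjoint_left.2 fun ω hi hj => hij ?_
    exact hi.2.symm.trans hj.2
  rw [hA, lintegral_iUnion hK' hd, lintegral_iUnion hK' hd]
  refine tsum_congr fun k => ?_
  have e1 : ∀ ω ∈ A ∩ K ⁻¹' {k}, K ω = k := fun ω hω => hω.2
  have e2 : ∫⁻ ω in A ∩ K ⁻¹' {k}, H (K ω) (X (c (K ω)) ω, postPath X (c (K ω)) ω) ∂P =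
      ∫⁻ ω in A ∩ K ⁻¹' {k}, H k (X (c k) ω, postPath X (c k) ω) ∂P :=
    setLIntegral_congr_fun (hK' k) fun ω hω => by simp only [e1 ω hω]
  have e3 : ∫⁻ ω in A ∩ K ⁻¹' {k}, ∫⁻ z, H (K ω) (X (c (K ω)) ω, z) ∂(pathLaw P X) ∂P =
      ∫⁻ ω in A ∩ K ⁻¹' {k}, ∫⁻ z, H k (X (c k) ω, z) ∂(pathLaw P X) ∂P :=
    setLIntegral_congr_fun (hK' k) fun ω hω => by simp only [e1 ω hω]
  rw [e2, e3, ← lintegral_indicator (hK' k), ← lintegral_indicator (hK' k)]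
  have := lintegral_of_indep (𝓕.le (c k)) (hX.measurable_postPath (c k))
    (hX.indep_postPath (c k))
    (W := fun ω => ((A ∩ K ⁻¹' {k}).indicator (1 : Ω → ℝ≥0∞) ω, X (c k) ω))
    ((measurable_indicator_one (hK k)).prodMk (hX.adapted _))
    (k := fun p : (ℝ≥0∞ × ℝ) × (ℚ≥0 → ℝ) => p.1.1 * H k (p.1.2, p.2))
    ((measurable_fst.comp measurable_fst).mul ((hH k).comp (by fun_prop)))
  rw [hX.map_postPath] at this
  refine Eq.trans (lintegral_congr fun ω => ?_) (this.trans (lintegral_congr fun ω => ?_))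
  · by_cases h : ω ∈ A ∩ K ⁻¹' {k}
    · simp only [Set.indicator_of_mem h, Pi.one_apply, one_mul]
    · simp only [Set.indicator_of_notMem h, zero_mul]
  · by_cases h : ω ∈ A ∩ K ⁻¹' {k}
    · simp only [Set.indicator_of_mem h, Pi.one_apply, one_mul]
    · simp only [Set.indicator_of_notMem h, zero_mul, lintegral_zero]

end IsLevyProcess

end

/-! ### Exponential times -/

section

lemma measurable_gammaPDF (a r : ℝ) : Measurable (gammaPDF a r) :=
  (measurable_gammaPDFReal a r).ennreal_ofReal

lemma ae_nonneg_expMeasure (r : ℝ) : ∀ᵐ v ∂(expMeasure r), 0 ≤ v := by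
  rw [expMeasure, gammaMeasure, ae_withDensity_iff (measurable_gammaPDF 1 r)]
  refine Eventually.of_forall fun v hv => ?_
  by_contra! h
  exact hv (gammaPDF_of_neg h)

lemma lintegral_expMeasure (r : ℝ) (F : ℝ → ℝ≥0∞) :
    ∫⁻ v, F v ∂(expMeasure r) = ∫⁻ v, exponentialPDF r v * F v := by
  rw [expMeasure, gammaMeasure, lintegral_withDensity_eq_lintegral_mul_non_measurable _
    (measurable_gammaPDF 1 r) (Eventually.of_forall fun v => by simp [gammaPDF])]
  rfl

/-- Lack of memory of the exponential law. -/
lemma lintegral_expMeasure_memoryless {r : ℝ} {s : ℝ} (hs : 0 ≤ s)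
    (F : ℝ → ℝ≥0∞) :
    ENNReal.ofReal (Real.exp (-r * s)) * ∫⁻ v, F v ∂(expMeasure r) =
      ∫⁻ u, (Set.Ici s).indicator (fun u => F (u - s)) u ∂(expMeasure r) := by
  rw [lintegral_expMeasure, lintegral_expMeasure, ← lintegral_const_mul' _ _ ENNReal.ofReal_ne_top,
    ← lintegral_sub_right_eq_self _ s]
  refine lintegral_congr fun u => ?_
  rcases lt_or_ge u s with h | h
  · rw [Set.indicator_of_notMem (by simpa using h), exponentialPDF_of_neg (by linarith)]
    simp
  · rw [Set.indicator_of_mem (show u ∈ Set.Ici s from h), exponentialPDF_of_nonneg (by linarith),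
      exponentialPDF_of_nonneg (by linarith), ← mul_assoc,
      ← ENNReal.ofReal_mul (Real.exp_pos _).le]
    congr 2
    rw [mul_left_comm, ← Real.exp_add]
    congr 2
    ring

/-- The mean of `φ (y + inf z)`, the infimum of the path `z` being taken up to an independent
exponential time of parameter `r`. -/
def infExp (r : ℝ) (φ : ℝ → ℝ≥0∞) (y : ℝ) (z : ℚ≥0 → ℝ) : ℝ≥0∞ :=
  ∫⁻ v, φ (y + ratInf z v) ∂(expMeasure r)

lemma measurable_infExp {r : ℝ} (hr : 0 < r) {φ : ℝ → ℝ≥0∞} (hφ : Measurable φ) :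
    Measurable fun p : ℝ × (ℚ≥0 → ℝ) => infExp r φ p.1 p.2 := by
  have := isProbabilityMeasure_expMeasure hr
  refine Measurable.lintegral_prod_right' (ν := expMeasure r)
    (f := fun p : (ℝ × (ℚ≥0 → ℝ)) × ℝ => φ (p.1.1 + ratInf p.1.2 p.2)) ?_
  exact hφ.comp (Measurable.add (by fun_prop) (measurable_ratInf (by fun_prop) measurable_snd))

lemma measurable_infExp_integrand {φ : ℝ → ℝ≥0∞} (hφ : Measurable φ) (y : ℝ) (z : ℚ≥0 → ℝ) :
    Measurable fun v => φ (y + ratInf z v) :=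
  hφ.comp (measurable_const.add (measurable_ratInf measurable_const measurable_id))

lemma infExp_le {r : ℝ} (hr : 0 < r) {φ : ℝ → ℝ≥0∞} {C : ℝ≥0∞} (hC : ∀ y, φ y ≤ C) (y : ℝ)
    (z : ℚ≥0 → ℝ) : infExp r φ y z ≤ C := by
  have := isProbabilityMeasure_expMeasure hr
  refine (lintegral_mono fun v => hC _).trans ?_
  simp

lemma iSup_min_natCast (a : ℝ≥0∞) : ⨆ n : ℕ, min a n = a := by
  have := inf_iSup_eq a (fun n : ℕ => (n : ℝ≥0∞))
  rw [ENNReal.iSup_natCast, inf_top_eq] at this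
  exact this.symm

lemma infExp_eq_iSup (r : ℝ) {φ : ℝ → ℝ≥0∞} (hφ : Measurable φ) (y : ℝ) (z : ℚ≥0 → ℝ) :
    infExp r φ y z = ⨆ n : ℕ, infExp r (fun y => min (φ y) n) y z := by
  unfold infExp
  rw [← lintegral_iSup (fun n => measurable_infExp_integrand (hφ.min measurable_const) y z)]
  · simp_rw [iSup_min_natCast]
  · intro n m hnm v
    exact min_le_min_left _ (by exact_mod_cast hnm)

lemma tendsto_infExp {r : ℝ} (hr : 0 < r) {φ : ℝ → ℝ≥0∞} (hφ : Continuous φ) {C : ℝ≥0∞}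
    (hC : ∀ y, φ y ≤ C) (hC' : C ≠ ⊤) {y : ℕ → ℝ} {z : ℕ → ℚ≥0 → ℝ} {y' : ℝ} {z' : ℚ≥0 → ℝ}
    (h : ∀ v, 0 ≤ v → Tendsto (fun m => y m + ratInf (z m) v) atTop (𝓝 (y' + ratInf z' v))) :
    Tendsto (fun m => infExp r φ (y m) (z m)) atTop (𝓝 (infExp r φ y' z')) := by
  have := isProbabilityMeasure_expMeasure hr
  refine tendsto_lintegral_of_dominated_convergence (fun _ => C)
    (fun m => measurable_infExp_integrand hφ.measurable _ _)
    (fun m => Eventually.of_forall fun v => hC _) (by simpa using hC') ?_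
  filter_upwards [ae_nonneg_expMeasure r] with v hv
  exact (hφ.tendsto _).comp (h v hv)

/-- The infimum of `f` over `[s, s + v]`, in terms of the recentred path after `s`. -/
lemma IsRegularPath.ratInf_post {f : ℝ≥0 → ℝ} (hf : IsRegularPath f) (s : ℝ≥0) {v : ℝ}
    (hv : 0 ≤ v) :
    f s + ratInf (fun q => f (s + q) - f s) v = pathInf (fun h => f (s + h)) v := by
  have h1 := (hf.comp_add s).add_const (-f s)
  have h2 := (hf.comp_add s).pathInf_add_const (-f s) hv
  rw [← h1.ratInf_eq hv] at h2
  simp only [← sub_eq_add_neg] at h2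
  rw [h2]; ring

variable {Ω : Type*} {mΩ : MeasurableSpace Ω} {P : Measure Ω}
  {𝓕 : Filtration ℝ≥0 mΩ} {X : ℝ≥0 → Ω → ℝ}

/-- The mean of `φ (I)` for the process departing from `y`, where `I` is its infimum up to an
independent exponential time of parameter `r`; it is computed from the law of the path. -/
def meanInf (P : Measure Ω) (X : ℝ≥0 → Ω → ℝ) (r : ℝ) (φ : ℝ → ℝ≥0∞) (y : ℝ) : ℝ≥0∞ :=
  ∫⁻ z, infExp r φ y z ∂(pathLaw P X)

/-! ### Dyadic approximation of random times from above -/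

/-- The index of the first dyadic number of level `m` that is strictly greater than `t`. -/
def dyadicIndex (m : ℕ) (t : ℝ≥0) : ℕ := ⌊2 ^ m * t⌋₊ + 1

/-- The `k`-th dyadic number of level `m`. -/
def dyadicPoint (m k : ℕ) : ℝ≥0 := k / 2 ^ m

/-- The first dyadic number of level `m` that is strictly greater than `t`. -/
def dyadicAbove (m : ℕ) (t : ℝ≥0) : ℝ≥0 := dyadicPoint m (dyadicIndex m t)

lemma lt_dyadicAbove (m : ℕ) (t : ℝ≥0) : t < dyadicAbove m t := by
  rw [dyadicAbove, dyadicPoint, lt_div_iff₀ (by positivity), mul_comm]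
  simpa [dyadicIndex] using Nat.lt_floor_add_one (2 ^ m * t)

lemma dyadicAbove_le (m : ℕ) (t : ℝ≥0) : dyadicAbove m t ≤ t + (1 / 2) ^ m := by
  rw [dyadicAbove, dyadicPoint, div_le_iff₀ (by positivity), add_mul, ← mul_pow]
  have := Nat.floor_le (zero_le (a := 2 ^ m * t))
  simp only [dyadicIndex, Nat.cast_add, Nat.cast_one]
  rw [one_div, inv_mul_cancel₀ two_ne_zero, one_pow, mul_comm t]
  exact add_le_add_left this 1

lemma tendsto_dyadicAbove (t : ℝ≥0) : Tendsto (fun m => dyadicAbove m t) atTop (𝓝 t) := by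
  refine tendsto_of_tendsto_of_tendsto_of_le_of_le tendsto_const_nhds ?_
    (fun m => (lt_dyadicAbove m t).le) (fun m => dyadicAbove_le m t)
  have h : Tendsto (fun m : ℕ => (1 / 2 : ℝ≥0) ^ m) atTop (𝓝 0) :=
    NNReal.tendsto_pow_atTop_nhds_zero_of_lt_one (by norm_num)
  simpa using h.const_add t

lemma measurable_dyadicIndex (m : ℕ) : Measurable (dyadicIndex m) :=
  (Nat.measurable_floor.comp (by fun_prop)).add_const 1

lemma IsRegularPath.tendsto_dyadicAbove {f : ℝ≥0 → ℝ} (hf : IsRegularPath f) (t h : ℝ≥0) :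
    Tendsto (fun m => f (dyadicAbove m t + h)) atTop (𝓝 (f (t + h))) := by
  refine (hf.right_cont (t + h)).tendsto.comp (tendsto_nhdsWithin_iff.2
    ⟨(TwoSidedStopping.tendsto_dyadicAbove t).add_const h, Eventually.of_forall fun m => ?_⟩)
  exact add_le_add_left (lt_dyadicAbove m t).le h

/-- An optional time: the strict events `{τ < t}` belong to `𝓕 t`. When the filtration is not
right-continuous this is weaker than being a stopping time; it is what hitting times of open sets
satisfy, and it suffices for the strong Markov property. -/
def IsOptionalTime (𝓕 : Filtration ℝ≥0 mΩ) (τ : Ω → WithTop ℝ≥0) : Prop :=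
  ∀ t : ℝ≥0, MeasurableSet[𝓕 t] {ω | τ ω < t}

lemma _root_.MeasureTheory.IsStoppingTime.isOptionalTime {τ : Ω → WithTop ℝ≥0}
    (hτ : IsStoppingTime 𝓕 τ) : IsOptionalTime 𝓕 τ := fun t => hτ.measurableSet_lt t

namespace IsOptionalTime

variable {τ : Ω → WithTop ℝ≥0}

lemma measurableSet_ne_top (hτ : IsOptionalTime 𝓕 τ) : MeasurableSet {ω | τ ω ≠ ⊤} := by
  have : {ω | τ ω ≠ ⊤} = ⋃ n : ℕ, {ω | τ ω < ((n : ℝ≥0) : WithTop ℝ≥0)} := by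
    ext ω
    simp only [Set.mem_ofPred_eq, Set.mem_iUnion]
    constructor
    · intro h
      lift τ ω to ℝ≥0 using h with t
      obtain ⟨n, hn⟩ := exists_nat_gt t
      exact ⟨n, WithTop.coe_lt_coe.2 hn⟩
    · rintro ⟨n, hn⟩
      exact hn.ne_top
  rw [this]
  exact MeasurableSet.iUnion fun n => 𝓕.le _ _ (hτ n)

lemma measurable_untopD (hτ : IsOptionalTime 𝓕 τ) : Measurable fun ω => (τ ω).untopD 0 := by
  refine measurable_of_Iio fun t => ?_
  have : (fun ω => (τ ω).untopD 0) ⁻¹' Set.Iio t =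
      {ω | τ ω < t} ∪ ({ω | τ ω ≠ ⊤}ᶜ ∩ {_ω | 0 < t}) := by
    ext ω
    simp only [Set.mem_preimage, Set.mem_Iio, Set.mem_union, Set.mem_ofPred_eq, Set.mem_inter_iff,
      Set.mem_compl_iff, ne_eq, not_not]
    cases τ ω with
    | top => simp only [WithTop.untopD_top, not_top_lt, false_or, true_and]
    | coe a => simp only [WithTop.untopD_coe, WithTop.coe_lt_coe, WithTop.coe_ne_top, false_and,
        or_false]
  rw [this]
  exact (𝓕.le _ _ (hτ t)).union (hτ.measurableSet_ne_top.compl.inter (MeasurableSet.const _))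

/-- The dyadic approximations of an optional time from above, being strict, are stopping times. -/
lemma measurableSet_dyadic (hτ : IsOptionalTime 𝓕 τ) (m k : ℕ) :
    MeasurableSet[𝓕 (dyadicPoint m k)]
      ({ω | τ ω ≠ ⊤} ∩ (fun ω => dyadicIndex m ((τ ω).untopD 0)) ⁻¹' {k}) := by
  cases k with
  | zero =>
    convert MeasurableSet.empty
    ext ω
    simp [dyadicIndex]
  | succ j =>
    have hle : dyadicPoint m j ≤ dyadicPoint m (j + 1) := by
      unfold dyadicPoint
      gcongr
      simp
    have : {ω | τ ω ≠ ⊤} ∩ (fun ω => dyadicIndex m ((τ ω).untopD 0)) ⁻¹' {j + 1} =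
        {ω | τ ω < dyadicPoint m (j + 1)} \ {ω | τ ω < dyadicPoint m j} := by
      ext ω
      cases h : τ ω with
      | top =>
        simp only [Set.mem_inter_iff, Set.mem_ofPred_eq, h, Set.mem_sdiff, ne_eq, not_true_eq_false,
          false_and, not_top_lt]
      | coe t =>
        simp only [Set.mem_inter_iff, Set.mem_ofPred_eq, h, Set.mem_preimage, WithTop.untopD_coe,
          Set.mem_singleton_iff, Set.mem_sdiff, WithTop.coe_lt_coe, not_lt, dyadicIndex, ne_eq,
          WithTop.coe_ne_top, not_false_eq_true, true_and, Nat.add_right_cancel_iff]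
        rw [Nat.floor_eq_iff (zero_le (a := 2 ^ m * t)), dyadicPoint, dyadicPoint,
          lt_div_iff₀ (by positivity), div_le_iff₀ (by positivity), mul_comm t]
        push_cast
        tauto
    rw [this]
    exact (hτ _).diff (𝓕.mono hle _ (hτ _))

end IsOptionalTime

/-! ### The strong Markov property at optional times -/

lemma measure_eventually_le {α : Type*} {mα : MeasurableSpace α} {μ : Measure α}
    {E : ℕ → Set α} {C : ℝ≥0∞} (h : ∀ᶠ m in atTop, μ (E m) ≤ C) :
    μ {ω | ∀ᶠ m in atTop, ω ∈ E m} ≤ C := by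
  have h1 : {ω | ∀ᶠ m in atTop, ω ∈ E m} = ⋃ N : ℕ, ⋂ m ≥ N, E m := by
    ext ω; simp [eventually_atTop]
  have h2 : Monotone fun N : ℕ => ⋂ m ≥ N, E m := fun N N' hN ω hω => by
    simp only [Set.mem_iInter] at hω ⊢
    exact fun m hm => hω m (hN.trans hm)
  rw [h1, h2.measure_iUnion]
  refine iSup_le fun N => ?_
  obtain ⟨m, hm, hNm⟩ := (h.and (eventually_ge_atTop N)).exists
  exact (measure_mono (Set.iInter₂_subset m hNm)).trans hm

namespace IsLevyProcess

lemma ae_isRegularPath (hX : IsLevyProcess P 𝓕 X) : ∀ᵐ ω ∂P, IsRegularPath fun t => X t ω :=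
  hX.cadlag.mono fun _ h => h.isRegularPath

lemma aemeasurable_eval (hX : IsLevyProcess P 𝓕 X) {T : Ω → ℝ≥0} (hT : Measurable T) (h : ℝ≥0) :
    AEMeasurable (fun ω => X (T ω + h) ω) P := by
  refine aemeasurable_of_tendsto_metrizable_ae' (f := fun m ω => X (dyadicAbove m (T ω) + h) ω)
    (fun m => Measurable.aemeasurable ?_) ?_
  · have h1 : Measurable fun p : ℕ × Ω => X (dyadicPoint m p.1 + h) p.2 :=
      measurable_from_prod_countable_right fun k => hX.measurable (dyadicPoint m k + h)
    have h2 : Measurable fun ω => (dyadicIndex m (T ω), ω) :=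
      ((measurable_dyadicIndex m).comp hT).prodMk measurable_id
    exact Measurable.comp (f := fun ω => (dyadicIndex m (T ω), ω)) h1 h2
  · filter_upwards [hX.ae_isRegularPath] with ω hω
    exact hω.tendsto_dyadicAbove (T ω) h

lemma aemeasurable_postPath (hX : IsLevyProcess P 𝓕 X) {T : Ω → ℝ≥0} (hT : Measurable T) :
    AEMeasurable (fun ω => (X (T ω) ω, postPath X (T ω) ω)) P := by
  have h0 : AEMeasurable (fun ω => X (T ω) ω) P := by simpa using hX.aemeasurable_eval hT 0
  exact h0.prodMk (aemeasurable_pi_iff.2 fun q => (hX.aemeasurable_eval hT q).sub h0)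

variable {τ : Ω → WithTop ℝ≥0}

lemma aemeasurable_discounted_infExp (hX : IsLevyProcess P 𝓕 X) (hτ : IsOptionalTime 𝓕 τ) {r : ℝ}
    (hr : 0 < r) {φ : ℝ → ℝ≥0∞} (hφ : Measurable φ) (x : ℝ) :
    AEMeasurable (fun ω => ENNReal.ofReal (Real.exp (-r * (τ ω).untopD 0)) *
      infExp r φ (x + X ((τ ω).untopD 0) ω) (postPath X ((τ ω).untopD 0) ω)) P := by
  have hT := hτ.measurable_untopD
  refine AEMeasurable.mul (Measurable.aemeasurable (by fun_prop)) ?_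
  have h1 : Measurable fun p : ℝ × (ℚ≥0 → ℝ) => infExp r φ (x + p.1) p.2 :=
    (measurable_infExp hr hφ).comp (f := fun p : ℝ × (ℚ≥0 → ℝ) => (x + p.1, p.2)) (by fun_prop)
  exact h1.comp_aemeasurable (hX.aemeasurable_postPath hT)

variable [IsProbabilityMeasure P]

/-- An increment of length `h` after an optional time is no more spread out than `X h`. -/
lemma measure_increment_gt_le (hX : IsLevyProcess P 𝓕 X) (hτ : IsOptionalTime 𝓕 τ) (h : ℚ≥0)
    (ε : ℝ) :
    P {ω | τ ω ≠ ⊤ ∧ ε < |X ((τ ω).untopD 0 + h) ω - X ((τ ω).untopD 0) ω|} ≤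
      P {ω | ε < |X h ω - X 0 ω|} := by
  have hpr := hX.isProbabilityMeasure_pathLaw
  set T : Ω → ℝ≥0 := fun ω => (τ ω).untopD 0 with hT
  set U : Set (ℚ≥0 → ℝ) := {z | ε < |z h|} with hU
  have hUm : MeasurableSet U := measurableSet_lt measurable_const (by fun_prop)
  set A : Set Ω := {ω | τ ω ≠ ⊤} with hA
  have hlaw : pathLaw P X U = P {ω | ε < |X h ω - X 0 ω|} := by
    rw [pathLaw, Measure.map_apply (hX.measurable_postPath 0) hUm]
    simp [hU, postPath]
  have hm : ∀ m, P (A ∩ {ω | postPath X (dyadicAbove m (T ω)) ω ∈ U}) ≤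
      P {ω | ε < |X h ω - X 0 ω|} := by
    intro m
    have key := hX.setLIntegral_postPath (hτ.measurableSet_dyadic m)
      (H := fun _ p => U.indicator 1 p.2)
      (fun _ => (measurable_indicator_one hUm).comp measurable_snd)
    have e2 : ∫⁻ ω in A, U.indicator 1 (postPath X (dyadicAbove m (T ω)) ω) ∂P =
        P (A ∩ {ω | postPath X (dyadicAbove m (T ω)) ω ∈ U}) := by
      have h3 : MeasurableSet {ω | postPath X (dyadicAbove m (T ω)) ω ∈ U} := by
        have h1 : Measurable fun p : ℕ × Ω => postPath X (dyadicPoint m p.1) p.2 :=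
          measurable_from_prod_countable_right fun k => hX.measurable_postPath (dyadicPoint m k)
        exact (h1.comp (((measurable_dyadicIndex m).comp hτ.measurable_untopD).prodMk
          measurable_id)) hUm
      rw [Set.inter_comm, ← Measure.restrict_apply h3, ← lintegral_indicator_one h3]
      rfl
    rw [← e2, ← hlaw]
    refine key.trans_le ?_
    simp only [lintegral_indicator_one hUm, lintegral_const, Measure.restrict_apply_univ]
    exact mul_le_of_le_one_right' prob_le_one
  refine le_trans (measure_mono_ae ?_) (measure_eventually_le (Eventually.of_forall hm))
  filter_upwards [hX.ae_isRegularPath] with ω hω hω'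
  have h1 := (hω.tendsto_dyadicAbove (T ω) h).sub (hω.tendsto_dyadicAbove (T ω) 0)
  simp only [add_zero] at h1
  filter_upwards [h1.abs.eventually_const_lt hω'.2] with m hm
  exact ⟨hω'.1, hm⟩

lemma tendsto_meanInf (hX : IsLevyProcess P 𝓕 X) {r : ℝ} (hr : 0 < r) {φ : ℝ → ℝ≥0∞}
    (hφ : Continuous φ) {C : ℝ≥0∞} (hC : ∀ y, φ y ≤ C) (hC' : C ≠ ⊤) {y : ℕ → ℝ} {y' : ℝ}
    (h : Tendsto y atTop (𝓝 y')) :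
    Tendsto (fun m => meanInf P X r φ (y m)) atTop (𝓝 (meanInf P X r φ y')) := by
  have hpr := hX.isProbabilityMeasure_pathLaw
  refine tendsto_lintegral_of_dominated_convergence (fun _ => C)
    (fun m => (measurable_infExp hr hφ.measurable).comp (measurable_const.prodMk measurable_id))
    (fun m => Eventually.of_forall fun z => infExp_le hr hC _ _) (by simpa using hC')
    (Eventually.of_forall fun z => ?_)
  exact tendsto_infExp hr hφ hC hC' fun v _ => h.add_const _

lemma meanInf_eq_iSup (hX : IsLevyProcess P 𝓕 X) {r : ℝ} (hr : 0 < r) {φ : ℝ → ℝ≥0∞}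
    (hφ : Measurable φ) (y : ℝ) :
    meanInf P X r φ y = ⨆ n : ℕ, meanInf P X r (fun y => min (φ y) n) y := by
  have hpr := hX.isProbabilityMeasure_pathLaw
  unfold meanInf
  rw [← lintegral_iSup]
  · simp_rw [infExp_eq_iSup r hφ]
  · exact fun n => (measurable_infExp hr (hφ.min measurable_const)).comp
      (measurable_const.prodMk measurable_id)
  · exact fun n m hnm z => lintegral_mono fun v => min_le_min_left _ (by exact_mod_cast hnm)

lemma measurable_meanInf (hX : IsLevyProcess P 𝓕 X) {r : ℝ} (hr : 0 < r) {φ : ℝ → ℝ≥0∞}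
    (hφ : Measurable φ) : Measurable (meanInf P X r φ) := by
  have hpr := hX.isProbabilityMeasure_pathLaw
  exact (measurable_infExp hr hφ).lintegral_prod_right' (ν := pathLaw P X)

lemma aemeasurable_discounted_meanInf (hX : IsLevyProcess P 𝓕 X) (hτ : IsOptionalTime 𝓕 τ) {r : ℝ}
    (hr : 0 < r) {φ : ℝ → ℝ≥0∞} (hφ : Measurable φ) (x : ℝ) :
    AEMeasurable (fun ω => ENNReal.ofReal (Real.exp (-r * (τ ω).untopD 0)) *
      meanInf P X r φ (x + X ((τ ω).untopD 0) ω)) P := by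
  have hT := hτ.measurable_untopD
  refine AEMeasurable.mul (Measurable.aemeasurable (by fun_prop)) ?_
  refine (hX.measurable_meanInf hr hφ).comp_aemeasurable (AEMeasurable.const_add ?_ x)
  simpa using hX.aemeasurable_eval hT 0

/-- Strong Markov property at an optional time for `infExp r φ`, with `φ` bounded: dominated
convergence along the dyadic approximations of `τ`. -/
lemma strong_markov_bounded (hX : IsLevyProcess P 𝓕 X) (hτ : IsOptionalTime 𝓕 τ) {r : ℝ}
    (hr : 0 < r) {φ : ℝ → ℝ≥0∞} (hφ : Continuous φ) {C : ℝ≥0∞} (hC : ∀ y, φ y ≤ C) (hC' : C ≠ ⊤)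
    (x : ℝ) :
    ∫⁻ ω in {ω | τ ω ≠ ⊤}, ENNReal.ofReal (Real.exp (-r * (τ ω).untopD 0)) *
        infExp r φ (x + X ((τ ω).untopD 0) ω) (postPath X ((τ ω).untopD 0) ω) ∂P =
      ∫⁻ ω in {ω | τ ω ≠ ⊤}, ENNReal.ofReal (Real.exp (-r * (τ ω).untopD 0)) *
        meanInf P X r φ (x + X ((τ ω).untopD 0) ω) ∂P := by
  have hpr := hX.isProbabilityMeasure_pathLaw
  set T : Ω → ℝ≥0 := fun ω => (τ ω).untopD 0 with hT
  set A : Set Ω := {ω | τ ω ≠ ⊤} with hA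
  set S : ℕ → Ω → ℝ≥0 := fun m ω => dyadicAbove m (T ω) with hS
  have hTm : Measurable T := hτ.measurable_untopD
  have hSm : ∀ m, Measurable (S m) := fun m => by
    have h1 : Measurable fun k : ℕ => dyadicPoint m k := measurable_from_top
    exact h1.comp ((measurable_dyadicIndex m).comp hTm)
  have hexp : ∀ t : ℝ≥0, ENNReal.ofReal (Real.exp (-r * t)) ≤ 1 := fun t => by
    rw [ENNReal.ofReal_le_one, Real.exp_le_one_iff]
    have := mul_nonneg hr.le t.coe_nonneg
    linarith
  have hmean : ∀ y, meanInf P X r φ y ≤ C := fun y => by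
    refine (lintegral_mono fun z => infExp_le hr hC y z).trans ?_
    simp
  have hlimexp : ∀ ω, Tendsto (fun m => ENNReal.ofReal (Real.exp (-r * S m ω))) atTop
      (𝓝 (ENNReal.ofReal (Real.exp (-r * T ω)))) := fun ω => by
    have h1 : Continuous fun t : ℝ≥0 => ENNReal.ofReal (Real.exp (-r * t)) :=
      ENNReal.continuous_ofReal.comp (by fun_prop)
    exact (h1.tendsto _).comp (tendsto_dyadicAbove (T ω))
  have hdisc : ∀ m,
      ∫⁻ ω in A, ENNReal.ofReal (Real.exp (-r * S m ω)) *
          infExp r φ (x + X (S m ω) ω) (postPath X (S m ω) ω) ∂P =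
        ∫⁻ ω in A, ENNReal.ofReal (Real.exp (-r * S m ω)) *
          meanInf P X r φ (x + X (S m ω) ω) ∂P := by
    intro m
    have h1 : Measurable fun p : ℝ × (ℚ≥0 → ℝ) => infExp r φ (x + p.1) p.2 :=
      (measurable_infExp hr hφ.measurable).comp
        (f := fun p : ℝ × (ℚ≥0 → ℝ) => (x + p.1, p.2)) (by fun_prop)
    refine (hX.setLIntegral_postPath (hτ.measurableSet_dyadic m)
      (H := fun k p => ENNReal.ofReal (Real.exp (-r * dyadicPoint m k)) *
        infExp r φ (x + p.1) p.2) (fun k => h1.const_mul _)).trans ?_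
    refine lintegral_congr fun ω => ?_
    dsimp only
    rw [lintegral_const_mul' _ _ ENNReal.ofReal_ne_top]
    rfl
  have hbound : ∀ {a b : ℝ≥0∞}, a ≤ 1 → b ≤ C → a * b ≤ C := fun ha hb =>
    (mul_le_mul' ha hb).trans (one_mul C).le
  have hfin : ∫⁻ _ω in A, C ∂P ≠ ⊤ := by
    rw [lintegral_const]
    exact ENNReal.mul_ne_top hC' (measure_ne_top _ _)
  have hfactor : ∀ {b : ℕ → ℝ≥0∞} {b' : ℝ≥0∞}, (b' ≠ ⊤) → ∀ ω, Tendsto b atTop (𝓝 b') →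
      Tendsto (fun m => ENNReal.ofReal (Real.exp (-r * S m ω)) * b m) atTop
        (𝓝 (ENNReal.ofReal (Real.exp (-r * T ω)) * b')) := fun hb ω h =>
    ENNReal.Tendsto.mul (hlimexp ω) (Or.inr hb) h (Or.inr ENNReal.ofReal_ne_top)
  have hl : Tendsto (fun m => ∫⁻ ω in A, ENNReal.ofReal (Real.exp (-r * S m ω)) *
      infExp r φ (x + X (S m ω) ω) (postPath X (S m ω) ω) ∂P) atTop
      (𝓝 (∫⁻ ω in A, ENNReal.ofReal (Real.exp (-r * T ω)) *
        infExp r φ (x + X (T ω) ω) (postPath X (T ω) ω) ∂P)) := by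
    refine tendsto_lintegral_of_dominated_convergence' (fun _ => C) (fun m => ?_)
      (fun m => Eventually.of_forall fun ω => hbound (hexp _) (infExp_le hr hC _ _)) hfin ?_
    · refine (AEMeasurable.mul (Measurable.aemeasurable (by have := hSm m; fun_prop)) ?_).restrict
      have h1 : Measurable fun p : ℝ × (ℚ≥0 → ℝ) => infExp r φ (x + p.1) p.2 :=
        (measurable_infExp hr hφ.measurable).comp
        (f := fun p : ℝ × (ℚ≥0 → ℝ) => (x + p.1, p.2)) (by fun_prop)
      exact h1.comp_aemeasurable (hX.aemeasurable_postPath (hSm m))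
    · filter_upwards [ae_restrict_of_ae hX.ae_isRegularPath] with ω hω
      refine hfactor (ne_top_of_le_ne_top hC' (infExp_le hr hC _ _)) ω ?_
      refine tendsto_infExp hr hφ hC hC' fun v hv => ?_
      simp only [add_assoc]
      have e : ∀ t : ℝ≥0, X t ω + ratInf (postPath X t ω) v = pathInf (fun h => X (t + h) ω) v :=
        fun t => hω.ratInf_post t hv
      simp only [e]
      exact (hω.tendsto_pathInf_shift (fun m => (lt_dyadicAbove m (T ω)).le)
        (tendsto_dyadicAbove (T ω)) hv).const_add x
  have hr' : Tendsto (fun m => ∫⁻ ω in A, ENNReal.ofReal (Real.exp (-r * S m ω)) *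
      meanInf P X r φ (x + X (S m ω) ω) ∂P) atTop
      (𝓝 (∫⁻ ω in A, ENNReal.ofReal (Real.exp (-r * T ω)) *
        meanInf P X r φ (x + X (T ω) ω) ∂P)) := by
    refine tendsto_lintegral_of_dominated_convergence' (fun _ => C) (fun m => ?_)
      (fun m => Eventually.of_forall fun ω => hbound (hexp _) (hmean _)) hfin ?_
    · refine (AEMeasurable.mul (Measurable.aemeasurable (by have := hSm m; fun_prop)) ?_).restrict
      refine (hX.measurable_meanInf hr hφ.measurable).comp_aemeasurable
        (AEMeasurable.const_add ?_ x)
      simpa using hX.aemeasurable_eval (hSm m) 0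
    · filter_upwards [ae_restrict_of_ae hX.ae_isRegularPath] with ω hω
      refine hfactor (ne_top_of_le_ne_top hC' (hmean _)) ω ?_
      refine hX.tendsto_meanInf hr hφ hC hC' ?_
      have := hω.tendsto_dyadicAbove (T ω) 0
      simp only [add_zero] at this
      exact this.const_add x
  simp_rw [hdisc] at hl
  exact tendsto_nhds_unique hl hr'

/-- Strong Markov property at an optional time for `infExp r φ`. -/
lemma strong_markov (hX : IsLevyProcess P 𝓕 X) (hτ : IsOptionalTime 𝓕 τ) {r : ℝ}
    (hr : 0 < r) {φ : ℝ → ℝ≥0∞} (hφ : Continuous φ) (x : ℝ) :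
    ∫⁻ ω in {ω | τ ω ≠ ⊤}, ENNReal.ofReal (Real.exp (-r * (τ ω).untopD 0)) *
        infExp r φ (x + X ((τ ω).untopD 0) ω) (postPath X ((τ ω).untopD 0) ω) ∂P =
      ∫⁻ ω in {ω | τ ω ≠ ⊤}, ENNReal.ofReal (Real.exp (-r * (τ ω).untopD 0)) *
        meanInf P X r φ (x + X ((τ ω).untopD 0) ω) ∂P := by
  have hmono : ∀ {n m : ℕ}, n ≤ m → ∀ y, min (φ y) n ≤ min (φ y) m := fun hnm y =>
    min_le_min_left _ (by exact_mod_cast hnm)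
  have hmeas : ∀ n : ℕ, Measurable fun y => min (φ y) n := fun n =>
    hφ.measurable.min measurable_const
  simp_rw [infExp_eq_iSup r hφ.measurable, hX.meanInf_eq_iSup hr hφ.measurable, ENNReal.mul_iSup]
  rw [lintegral_iSup', lintegral_iSup']
  · refine iSup_congr fun n => ?_
    exact hX.strong_markov_bounded hτ hr (hφ.min continuous_const) (C := n)
      (fun y => min_le_right _ _) (ENNReal.natCast_ne_top n) x
  · exact fun n => (hX.aemeasurable_discounted_meanInf hτ hr (hmeas n) x).restrict
  · refine Eventually.of_forall fun ω n m hnm => mul_le_mul_right ?_ _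
    exact lintegral_mono fun z => lintegral_mono fun v => hmono hnm _
  · exact fun n => (hX.aemeasurable_discounted_infExp hτ hr (hmeas n) x).restrict
  · refine Eventually.of_forall fun ω n m hnm => mul_le_mul_right ?_ _
    exact lintegral_mono fun v => hmono hnm _

end IsLevyProcess

end

/-! ### Running infima after a random time -/

section

variable {Ω : Type*} {mΩ : MeasurableSpace Ω} {P : Measure Ω}
  {𝓕 : Filtration ℝ≥0 mΩ} {X : ℝ≥0 → Ω → ℝ}

namespace IsRegularPath

variable {f : ℝ≥0 → ℝ}

lemma infExp_post (hf : IsRegularPath f) (r : ℝ) (φ : ℝ → ℝ≥0∞) (x : ℝ) (s : ℝ≥0) :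
    infExp r φ (x + f s) (fun q => f (s + q) - f s) =
      ∫⁻ v, φ (x + pathInf (fun h => f (s + h)) v) ∂(expMeasure r) := by
  refine lintegral_congr_ae ?_
  filter_upwards [ae_nonneg_expMeasure r] with v hv
  rw [add_assoc, hf.ratInf_post s hv]

lemma pathInf_le_shift (hf : IsRegularPath f) {s : ℝ≥0} {u : ℝ} (hu : s ≤ u) :
    pathInf f u ≤ pathInf (fun h => f (s + h)) (u - s) :=
  le_pathInf (by linarith) fun t ht => hf.pathInf_le (by push_cast; linarith)

/-- The discounted functional of the infimum after time `s` is at most the functional of the infimum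
from time `0`, since the latter infimum is smaller. -/
lemma discounted_infExp_le (hf : IsRegularPath f) (r : ℝ) {φ : ℝ → ℝ≥0∞}
    (hφ : Antitone φ) (x : ℝ) (s : ℝ≥0) :
    ENNReal.ofReal (Real.exp (-r * s)) * infExp r φ (x + f s) (fun q => f (s + q) - f s) ≤
      ∫⁻ u, φ (x + pathInf f u) ∂(expMeasure r) := by
  rw [hf.infExp_post, lintegral_expMeasure_memoryless s.coe_nonneg]
  refine lintegral_mono fun u => ?_
  by_cases hu : u ∈ Set.Ici (s : ℝ)
  · rw [Set.indicator_of_mem hu]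
    exact hφ (add_le_add_right (hf.pathInf_le_shift hu) x)
  · rw [Set.indicator_of_notMem hu]
    exact zero_le (a := φ (x + pathInf f u))

/-- Equality holds if the path stays in the region where `φ` vanishes until time `s`: the path
before `s` then has no influence on the value of `φ` at the infimum. -/
lemma discounted_infExp_eq (hf : IsRegularPath f) (r : ℝ) {φ : ℝ → ℝ≥0∞} {a x : ℝ}
    (hφ0 : ∀ y, a ≤ y → φ y = 0) {s : ℝ≥0} (hs : ∀ t < s, a ≤ x + f t) :
    ENNReal.ofReal (Real.exp (-r * s)) * infExp r φ (x + f s) (fun q => f (s + q) - f s) =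
      ∫⁻ u, φ (x + pathInf f u) ∂(expMeasure r) := by
  rw [hf.infExp_post, lintegral_expMeasure_memoryless s.coe_nonneg]
  refine lintegral_congr_ae ?_
  filter_upwards [ae_nonneg_expMeasure r] with u hu
  have hpost : ∀ t : ℝ≥0, (t : ℝ) ≤ u → s ≤ t →
      pathInf (fun h => f (s + h)) (u - s) ≤ f t := fun t ht hst => by
    have h1 := (hf.comp_add s).pathInf_le (t := t - s) (u := u - s)
      (by rw [NNReal.coe_sub hst]; linarith)
    rwa [add_tsub_cancel_of_le hst] at h1
  rcases lt_or_ge u s with h | h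
  · rw [Set.indicator_of_notMem (by simpa using h), hφ0]
    have : a - x ≤ pathInf f u := le_pathInf hu fun t ht => by
      have := hs t (NNReal.coe_lt_coe.1 (lt_of_le_of_lt ht h))
      linarith
    linarith
  · rw [Set.indicator_of_mem (show u ∈ Set.Ici (s : ℝ) from h)]
    have hle := hf.pathInf_le_shift h
    rcases le_or_gt a (x + pathInf (fun h => f (s + h)) (u - s)) with hJ | hJ
    -- Both infima are at least `a`, or else the smaller one is reached after time `s`.
    · rw [hφ0 _ hJ, hφ0]
      have : a - x ≤ pathInf f u := le_pathInf hu fun t ht => by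
        rcases lt_or_ge t s with hts | hts
        · have := hs t hts
          linarith
        · have := hpost t ht hts
          linarith
      linarith
    · congr 2
      refine le_antisymm (le_pathInf hu fun t ht => ?_) hle
      rcases lt_or_ge t s with hts | hts
      · have := hs t hts
        linarith
      · exact hpost t ht hts

end IsRegularPath

namespace IsLevyProcess

lemma neg (hX : IsLevyProcess P 𝓕 X) : IsLevyProcess P 𝓕 fun t ω => -X t ω where
  adapted t := (hX.adapted t).neg
  start_zero := hX.start_zero.mono fun ω h => by simp [h]
  cadlag := hX.cadlag.mono fun ω h => h.neg
  indep_increments s h := by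
    refine indep_of_indep_of_le_left (hX.indep_increments s h) ?_
    have : (fun ω => -X (s + h) ω - -X s ω) =
        (fun y : ℝ => -y) ∘ fun ω => X (s + h) ω - X s ω := by
      ext ω
      simp only [Function.comp_apply]
      ring
    rw [this, ← MeasurableSpace.comap_comp]
    exact MeasurableSpace.comap_mono measurable_neg.comap_le
  stationary_increments s h := by
    have := (hX.stationary_increments s h).comp measurable_neg
    convert this using 1
    · ext ω
      simp only [Function.comp_apply]
      ring
    · rfl

lemma ae_runInf_eq [SFinite P] (hX : IsLevyProcess P 𝓕 X) {r : ℝ} (hr : 0 < r) (x : ℝ) :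
    ∀ᵐ p ∂(P.prod (expMeasure r)),
      runInf (startedAt X x) p = x + ratInf (postPath X 0 p.1) p.2 := by
  have := isProbabilityMeasure_expMeasure hr
  have h1 := Measure.quasiMeasurePreserving_fst (μ := P) (ν := expMeasure r) |>.ae
    (hX.ae_isRegularPath.and hX.start_zero)
  have h2 := Measure.quasiMeasurePreserving_snd (μ := P) (ν := expMeasure r) |>.ae
    (ae_nonneg_expMeasure r)
  filter_upwards [h1, h2] with p hp hv
  have h3 := hp.1.ratInf_post 0 hv
  have h4 := hp.1.pathInf_add_const x hv
  simp only [hp.2, zero_add] at h3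
  have h5 : runInf (startedAt X x) p = pathInf (fun h => X h p.1 + x) p.2 := by
    simp only [runInf, pathInf, startedAt, add_comm]
  have h6 : postPath X 0 p.1 = fun q : ℚ≥0 => X q p.1 - 0 := by
    ext q
    simp only [postPath, zero_add, hp.2]
  rw [h5, h4, ← h3, h6, add_comm]

lemma measurable_postPath_integrand (hX : IsLevyProcess P 𝓕 X) {φ : ℝ → ℝ≥0∞}
    (hφ : Measurable φ) (x : ℝ) :
    Measurable fun p : Ω × ℝ => φ (x + ratInf (postPath X 0 p.1) p.2) := by
  have h0 : Measurable fun p : Ω × ℝ => postPath X 0 p.1 :=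
    Measurable.comp (g := postPath X 0) (f := Prod.fst) (hX.measurable_postPath 0) measurable_fst
  have h2 : Measurable fun p : Ω × ℝ => ratInf (postPath X 0 p.1) p.2 :=
    measurable_ratInf h0 measurable_snd
  exact hφ.comp (h2.const_add x)

lemma aemeasurable_runInf [SFinite P] (hX : IsLevyProcess P 𝓕 X) {r : ℝ} (hr : 0 < r)
    {φ : ℝ → ℝ≥0∞} (hφ : Measurable φ) (x : ℝ) :
    AEMeasurable (fun p => φ (runInf (startedAt X x) p)) (P.prod (expMeasure r)) :=
  (hX.measurable_postPath_integrand hφ x).aemeasurable.congr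
    ((hX.ae_runInf_eq hr x).mono fun _ hp => (congrArg φ hp).symm)

lemma meanInf_eq_lintegral_infExp (hX : IsLevyProcess P 𝓕 X) {r : ℝ} (hr : 0 < r)
    {φ : ℝ → ℝ≥0∞} (hφ : Measurable φ) (x : ℝ) :
    meanInf P X r φ x = ∫⁻ ω, infExp r φ x (postPath X 0 ω) ∂P :=
  lintegral_map ((measurable_infExp hr hφ).comp (measurable_const.prodMk measurable_id))
    (hX.measurable_postPath 0)

lemma meanInf_eq_lintegral_pathInf (hX : IsLevyProcess P 𝓕 X) {r : ℝ} (hr : 0 < r)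
    {φ : ℝ → ℝ≥0∞} (hφ : Measurable φ) (x : ℝ) :
    meanInf P X r φ x =
      ∫⁻ ω, ∫⁻ u, φ (x + pathInf (fun t => X t ω) u) ∂(expMeasure r) ∂P := by
  rw [hX.meanInf_eq_lintegral_infExp hr hφ]
  refine lintegral_congr_ae ?_
  filter_upwards [hX.ae_isRegularPath, hX.start_zero] with ω hω h0
  have := hω.infExp_post r φ x 0
  simp only [h0, add_zero, zero_add] at this
  have h6 : postPath X 0 ω = fun q : ℚ≥0 => X q ω - 0 := by
    ext q
    simp only [postPath, zero_add, h0]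
  rw [← this, h6]

lemma lintegral_runInf_eq_meanInf [SFinite P] (hX : IsLevyProcess P 𝓕 X) {r : ℝ} (hr : 0 < r)
    {φ : ℝ → ℝ≥0∞} (hφ : Measurable φ) (x : ℝ) :
    ∫⁻ p, φ (runInf (startedAt X x) p) ∂(P.prod (expMeasure r)) = meanInf P X r φ x := by
  have := isProbabilityMeasure_expMeasure hr
  rw [hX.meanInf_eq_lintegral_infExp hr hφ, lintegral_congr_ae
    ((hX.ae_runInf_eq hr x).mono fun p hp => congrArg φ hp),
    lintegral_prod _ (hX.measurable_postPath_integrand hφ x).aemeasurable]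
  rfl

variable [IsProbabilityMeasure P]

/-- The process `e^{-rt} E_{X_t} φ(I)` has the supermartingale inequality at optional times. -/
lemma setLIntegral_discounted_meanInf_le (hX : IsLevyProcess P 𝓕 X) {τ : Ω → WithTop ℝ≥0}
    (hτ : IsOptionalTime 𝓕 τ) {r : ℝ} (hr : 0 < r) {φ : ℝ → ℝ≥0∞} (hφ : Continuous φ)
    (hφ' : Antitone φ) (x : ℝ) :
    ∫⁻ ω in {ω | τ ω ≠ ⊤}, ENNReal.ofReal (Real.exp (-r * (τ ω).untopD 0)) *
        meanInf P X r φ (x + X ((τ ω).untopD 0) ω) ∂P ≤ meanInf P X r φ x := by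
  rw [← hX.strong_markov hτ hr hφ, hX.meanInf_eq_lintegral_pathInf hr hφ.measurable]
  refine (setLIntegral_le_lintegral _ _).trans (lintegral_mono_ae ?_)
  filter_upwards [hX.ae_isRegularPath] with ω hω
  exact hω.discounted_infExp_le r hφ' x _

/-- The supermartingale inequality is an equality at an optional time before which the process stays
in a half-line `[a, ∞)` on which `φ` vanishes. -/
lemma setLIntegral_discounted_meanInf_eq (hX : IsLevyProcess P 𝓕 X) {τ : Ω → WithTop ℝ≥0}
    (hτ : IsOptionalTime 𝓕 τ) {r : ℝ} (hr : 0 < r) {φ : ℝ → ℝ≥0∞} (hφ : Continuous φ)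
    {a x : ℝ} (hφ0 : ∀ y, a ≤ y → φ y = 0)
    (hbefore : ∀ᵐ ω ∂P, ∀ t : ℝ≥0, t < τ ω → a ≤ x + X t ω) :
    ∫⁻ ω in {ω | τ ω ≠ ⊤}, ENNReal.ofReal (Real.exp (-r * (τ ω).untopD 0)) *
        meanInf P X r φ (x + X ((τ ω).untopD 0) ω) ∂P = meanInf P X r φ x := by
  rw [← hX.strong_markov hτ hr hφ, hX.meanInf_eq_lintegral_pathInf hr hφ.measurable,
    ← lintegral_indicator hτ.measurableSet_ne_top]
  refine lintegral_congr_ae ?_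
  filter_upwards [hX.ae_isRegularPath, hbefore] with ω hω hb
  rcases eq_or_ne (τ ω) ⊤ with h | h
  · rw [Set.indicator_of_notMem (by simpa using h)]
    symm
    refine (lintegral_congr_ae ?_).trans lintegral_zero
    filter_upwards [ae_nonneg_expMeasure r] with u hu
    refine hφ0 _ ?_
    have : a - x ≤ pathInf (fun t => X t ω) u := le_pathInf hu fun t _ => by
      have := hb t (by rw [h]; exact WithTop.coe_lt_top t)
      linarith
    linarith
  · rw [Set.indicator_of_mem (show ω ∈ {ω | τ ω ≠ ⊤} from h)]
    refine hω.discounted_infExp_eq r hφ0 fun t ht => hb t ?_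
    obtain ⟨s, hs⟩ := WithTop.ne_top_iff_exists.1 h
    rw [← hs] at ht ⊢
    exact WithTop.coe_lt_coe.2 ht

end IsLevyProcess

end

/-! ### First entry times into closed sets -/

section

variable {Ω : Type*} {mΩ : MeasurableSpace Ω} {P : Measure Ω}
  {𝓕 : Filtration ℝ≥0 mΩ} {X : ℝ≥0 → Ω → ℝ}

lemma coe_untopD {a : WithTop ℝ≥0} (ha : a ≠ ⊤) : ((a.untopD 0 : ℝ≥0) : WithTop ℝ≥0) = a := by
  lift a to ℝ≥0 using ha
  rfl

lemma mem_of_forall_mem_cthickening {C : Set ℝ} (hC : IsClosed C) {y : ℝ}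
    (h : ∀ᶠ n : ℕ in atTop, y ∈ Metric.cthickening (1 / ((n : ℝ) + 1)) C) : y ∈ C := by
  rw [← hC.closure_eq, Metric.closure_eq_iInter_cthickening]
  simp only [Set.mem_iInter]
  intro δ hδ
  obtain ⟨n, hn, hnδ⟩ := (h.and
    (tendsto_one_div_add_atTop_nhds_zero_nat.eventually_lt_const hδ)).exists
  exact Metric.cthickening_mono hnδ.le C hn

/-- If `f` comes arbitrarily close to the closed set `C` along times `S n ≤ t` but does not meet `C`
up to time `t`, then it jumps at `T = sup S n` away from its left limit, which is in `C`. This jump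
is visible in the increments over `[S n, S n + h]`, for `h` small and then `n` large. -/
lemma IsCadlag.eventually_jump_lt {f : ℝ≥0 → ℝ} (hf : IsCadlag f) {C : Set ℝ} (hC : IsClosed C)
    {t : ℝ≥0} (hfC : ∀ s ≤ t, f s ∉ C) {S : ℕ → ℝ≥0} (hS : Monotone S) (hSt : ∀ n, S n ≤ t)
    (hSC : ∀ n : ℕ, f (S n) ∈ Metric.cthickening (1 / ((n : ℝ) + 1)) C) :
    ∃ j : ℕ, ∀ᶠ i : ℕ in atTop, ∀ᶠ n in atTop, 1 / ((j : ℝ) + 1) <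
      |f (S n + ((1 / ((i : ℚ≥0) + 1) : ℚ≥0) : ℝ≥0)) - f (S n)| := by
  have hbdd : BddAbove (Set.range S) := ⟨t, by rintro _ ⟨n, rfl⟩; exact hSt n⟩
  set T : ℝ≥0 := iSup S with hT
  have hlim : Tendsto S atTop (𝓝 T) := tendsto_atTop_ciSup hS hbdd
  have hTt : T ≤ t := ciSup_le hSt
  have hle : ∀ n, S n ≤ T := fun n => le_ciSup hbdd n
  -- If the supremum were attained, `f T` would be in every closed thickening of `C`.
  have hlt : ∀ n, S n < T := fun n₀ => by
    refine lt_of_le_of_ne (hle n₀) fun h => hfC T hTt (mem_of_forall_mem_cthickening hC ?_)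
    filter_upwards [eventually_ge_atTop n₀] with n hn
    have : S n = T := le_antisymm (hle n) (h ▸ hS hn)
    exact this ▸ hSC n
  obtain ⟨hr, l, hl⟩ := hf T
  have hfl : Tendsto (fun n => f (S n)) atTop (𝓝 l) :=
    hl.comp (tendsto_nhdsWithin_iff.2 ⟨hlim, Eventually.of_forall hlt⟩)
  have hlC : l ∈ C := by
    refine mem_of_forall_mem_cthickening hC (Eventually.of_forall fun n₀ => ?_)
    refine Metric.isClosed_cthickening.mem_of_tendsto hfl ?_
    filter_upwards [eventually_ge_atTop n₀] with n hn
    exact Metric.cthickening_mono (one_div_le_one_div_of_le (by positivity) (by gcongr)) C (hSC n)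
  have hne : f T ≠ l := fun h => hfC T hTt (h ▸ hlC)
  have hε : 0 < |f T - l| := abs_pos.2 (sub_ne_zero.2 hne)
  set ε := |f T - l| with hεdef
  obtain ⟨j, hj⟩ := exists_nat_one_div_lt (half_pos hε)
  have h1 : ∀ᶠ u in 𝓝[≥] T, |f u - f T| < ε / 4 := by
    have := (hr.tendsto.sub_const (f T)).abs
    rw [sub_self, abs_zero] at this
    exact this.eventually_lt_const (by linarith)
  have h2 : ∀ᶠ n in atTop, |f (S n) - l| < ε / 4 := by
    have := (hfl.sub_const l).abs
    rw [sub_self, abs_zero] at this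
    exact this.eventually_lt_const (by linarith)
  obtain ⟨ρ, hρ, hρ'⟩ := mem_nhdsGE_iff_exists_Ico_subset.1 h1
  have hgap : ∀ i : ℕ, ((1 / ((i : ℚ≥0) + 1) : ℚ≥0) : ℝ≥0) = 1 / ((i : ℝ≥0) + 1) := fun i => by
    push_cast; rfl
  refine ⟨j, ?_⟩
  have h3 : ∀ᶠ i : ℕ in atTop, T + 1 / ((i : ℝ≥0) + 1) < ρ := by
    have : Tendsto (fun i : ℕ => T + 1 / ((i : ℝ≥0) + 1)) atTop (𝓝 (T + 0)) :=
      tendsto_const_nhds.add tendsto_one_div_add_atTop_nhds_zero_nat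
    rw [add_zero] at this
    exact this.eventually_lt_const hρ
  filter_upwards [h3] with i hi
  rw [hgap]
  set h : ℝ≥0 := 1 / ((i : ℝ≥0) + 1) with hh
  have hpos : 0 < h := by positivity
  have h4 : ∀ᶠ n in atTop, T < S n + h := by
    have := hlim.add_const h
    exact this.eventually_const_lt (lt_add_of_pos_right T hpos)
  filter_upwards [h2, h4] with n hn2 hn4
  have h5 : |f (S n + h) - f T| < ε / 4 :=
    hρ' ⟨hn4.le, (add_le_add_left (hle n) h).trans_lt hi⟩
  have h6 : ε ≤ |f (S n + h) - f T| + |f (S n + h) - f (S n)| + |f (S n) - l| := by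
    have e : f T - l = -(f (S n + h) - f T) + (f (S n + h) - f (S n)) + (f (S n) - l) := by ring
    calc ε = |-(f (S n + h) - f T) + (f (S n + h) - f (S n)) + (f (S n) - l)| := by rw [← e]
      _ ≤ _ := by
        refine (abs_add_le _ _).trans (add_le_add_left ((abs_add_le _ _).trans ?_) _)
        rw [abs_neg]
  linarith

/-- In a complete filtration, membership in `𝓕 t` depends on an event only up to null sets. -/
lemma IsCompleteFiltration.measurableSet_congr (h𝓕 : IsCompleteFiltration P 𝓕) {A B : Set Ω}
    (hAB : A =ᵐ[P] B) {t : ℝ≥0} (hB : MeasurableSet[𝓕 t] B) : MeasurableSet[𝓕 t] A := by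
  have h0 : 𝓕 0 ≤ 𝓕 t := 𝓕.mono (zero_le (a := t))
  have h := ae_eq_set.1 hAB
  have h1 : A = (B \ (B \ A)) ∪ (A \ B) := by
    ext ω; simp only [Set.mem_union, Set.mem_sdiff]; tauto
  rw [h1]
  exact (hB.diff (h0 _ (h𝓕 _ h.2))).union (h0 _ (h𝓕 _ h.1))

/-- By right-continuity, the path is in the closure of `C` at the first entry time into `C`. -/
lemma hittingAfter_mem_closure {C : Set ℝ} {ω : Ω}
    (hω : ∀ t, ContinuousWithinAt (fun t => X t ω) (Set.Ici t) t)
    (h : hittingAfter X C 0 ω ≠ ⊤) :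
    X ((hittingAfter X C 0 ω).untopD 0) ω ∈ closure C := by
  have hex : ∃ s, 0 ≤ s ∧ X s ω ∈ C := by
    by_contra hc
    exact h (if_neg hc)
  have hval : hittingAfter X C 0 ω = (sInf {s : ℝ≥0 | 0 ≤ s ∧ X s ω ∈ C} : ℝ≥0) := if_pos hex
  rw [hval, WithTop.untopD_coe]
  set B := {s : ℝ≥0 | 0 ≤ s ∧ X s ω ∈ C}
  have hsub : B ⊆ Set.Ici (sInf B) := fun s hs => csInf_le (OrderBot.bddBelow _) hs
  exact ((hω (sInf B)).mono hsub).mem_closure (csInf_mem_closure hex (OrderBot.bddBelow _))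
    fun s hs => hs.2

namespace IsLevyProcess

lemma isOptionalTime_hittingAfter (hX : IsLevyProcess P 𝓕 X) (h𝓕 : IsCompleteFiltration P 𝓕)
    {O : Set ℝ} (hO : IsOpen O) : IsOptionalTime 𝓕 (hittingAfter X O 0) := by
  intro t
  refine h𝓕.measurableSet_congr (B := ⋃ (q : ℚ≥0) (_ : (q : ℝ≥0) < t), {ω | X q ω ∈ O}) ?_ ?_
  · filter_upwards [hX.ae_isRegularPath] with ω hω
    refine propext ?_
    change hittingAfter X O 0 ω < t ↔ ω ∈ ⋃ (q : ℚ≥0) (_ : (q : ℝ≥0) < t), {ω | X q ω ∈ O}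
    rw [hittingAfter_lt_iff]
    simp only [Set.mem_iUnion, Set.mem_ofPred_eq, exists_prop]
    constructor
    · rintro ⟨s, hs, hsO⟩
      obtain ⟨q, -, hq, hqO⟩ := exists_nnrat_of_right_cont (hω.right_cont s) hs.2 hO hsO
      exact ⟨q, hq, hqO⟩
    · rintro ⟨q, hq, hqO⟩
      exact ⟨q, ⟨zero_le (a := (q : ℝ≥0)), hq⟩, hqO⟩
  · refine MeasurableSet.iUnion fun q => MeasurableSet.iUnion fun hq => ?_
    exact hX.measurable_of_le hq.le hO.measurableSet

variable [IsProbabilityMeasure P]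

lemma tendsto_measure_increment (hX : IsLevyProcess P 𝓕 X) {ε : ℝ} (hε : 0 < ε) :
    Tendsto (fun i : ℕ => P {ω | ε < |X ((1 / ((i : ℚ≥0) + 1) : ℚ≥0) : ℝ≥0) ω - X 0 ω|}) atTop
      (𝓝 0) := by
  have h1 : TendstoInMeasure P (fun (i : ℕ) ω => X ((1 / ((i : ℚ≥0) + 1) : ℚ≥0) : ℝ≥0) ω) atTop
      (X 0) := by
    refine tendstoInMeasure_of_tendsto_ae (fun i => (hX.measurable _).aestronglyMeasurable) ?_
    filter_upwards [hX.ae_isRegularPath] with ω hω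
    refine (hω.right_cont 0).tendsto.comp
      (tendsto_nhdsWithin_iff.2 ⟨?_, Eventually.of_forall fun i => ?_⟩)
    · push_cast
      exact tendsto_one_div_add_atTop_nhds_zero_nat
    · exact zero_le (a := ((1 / ((i : ℚ≥0) + 1) : ℚ≥0) : ℝ≥0))
  rw [tendstoInMeasure_iff_norm] at h1
  refine tendsto_of_tendsto_of_tendsto_of_le_of_le tendsto_const_nhds (h1 ε hε)
    (fun i => zero_le (a := P _)) fun i => measure_mono fun ω hω => ?_
  simp only [Set.mem_ofPred_eq, Real.norm_eq_abs] at hω ⊢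
  exact hω.le

/-- A form of quasi-left-continuity: almost surely, `X` does not come arbitrarily close to a closed
set up to time `t` without meeting it. -/
lemma measure_approach_without_hitting (hX : IsLevyProcess P 𝓕 X)
    (h𝓕 : IsCompleteFiltration P 𝓕) {C : Set ℝ} (hC : IsClosed C) (t : ℝ≥0) :
    P {ω | (∀ n : ℕ, hittingAfter X (Metric.thickening (1 / ((n : ℝ) + 1)) C) 0 ω ≤ t) ∧
      ∀ s ≤ t, X s ω ∉ C} = 0 := by
  set τ : ℕ → Ω → WithTop ℝ≥0 := fun n =>
    hittingAfter X (Metric.thickening (1 / ((n : ℝ) + 1)) C) 0 with hτdef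
  have hτ : ∀ n, IsOptionalTime 𝓕 (τ n) := fun n =>
    hX.isOptionalTime_hittingAfter h𝓕 Metric.isOpen_thickening
  set E : ℕ → ℕ → ℕ → Set Ω := fun j i n => {ω | τ n ω ≠ ⊤ ∧ 1 / ((j : ℝ) + 1) <
    |X ((τ n ω).untopD 0 + ((1 / ((i : ℚ≥0) + 1) : ℚ≥0) : ℝ≥0)) ω - X ((τ n ω).untopD 0) ω|}
    with hE
  have hsub : {ω | (∀ n : ℕ, τ n ω ≤ t) ∧ ∀ s ≤ t, X s ω ∉ C} ≤ᵐ[P]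
      ⋃ j, {ω | ∀ᶠ i in atTop, ω ∈ {ω | ∀ᶠ n in atTop, ω ∈ E j i n}} := by
    filter_upwards [hX.cadlag] with ω hω hbad
    have hne : ∀ n, τ n ω ≠ ⊤ := fun n =>
      ne_top_of_le_ne_top WithTop.coe_ne_top (hbad.1 n)
    have hcoe : ∀ n, (((τ n ω).untopD 0 : ℝ≥0) : WithTop ℝ≥0) = τ n ω := fun n =>
      coe_untopD (hne n)
    have hmono : Monotone fun n => (τ n ω).untopD 0 := fun n m hnm => by
      refine WithTop.coe_le_coe.1 ?_
      rw [hcoe n, hcoe m]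
      refine hittingAfter_anti X 0 (Metric.thickening_mono ?_ C) ω
      exact one_div_le_one_div_of_le (by positivity) (by gcongr)
    obtain ⟨j, hj⟩ := hω.eventually_jump_lt hC hbad.2 hmono
      (fun n => WithTop.coe_le_coe.1 ((hcoe n).le.trans (hbad.1 n)))
      fun n => Metric.closure_thickening_subset_cthickening _ _
        (hittingAfter_mem_closure (fun t => (hω t).1) (hne n))
    refine Set.mem_iUnion.2 ⟨j, ?_⟩
    filter_upwards [hj] with i hi
    filter_upwards [hi] with n hn
    exact ⟨hne n, hn⟩
  refine le_antisymm ((measure_mono_ae hsub).trans ?_) (zero_le (a := P _))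
  rw [nonpos_iff_eq_zero, measure_iUnion_null_iff]
  intro j
  refine le_antisymm (le_of_forall_pos_le_add fun δ hδ => ?_) (zero_le (a := P _))
  rw [zero_add]
  refine measure_eventually_le ?_
  -- For each jump size, the increments over short intervals exceed it with small probability.
  have hpos : (0 : ℝ) < 1 / ((j : ℝ) + 1) := by positivity
  filter_upwards [(hX.tendsto_measure_increment hpos).eventually_lt_const hδ] with i hi
  exact (measure_eventually_le (Eventually.of_forall fun n =>
    hX.measure_increment_gt_le (hτ n) _ _)).trans hi.le

/-- The first entry time into a closed set is a stopping time of a complete filtration, without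
right-continuity of the filtration. -/
lemma isStoppingTime_hittingAfter (hX : IsLevyProcess P 𝓕 X) (h𝓕 : IsCompleteFiltration P 𝓕)
    {C : Set ℝ} (hC : IsClosed C) : IsStoppingTime 𝓕 (hittingAfter X C 0) := by
  intro t
  set O : ℕ → Set ℝ := fun n => Metric.thickening (1 / ((n : ℝ) + 1)) C with hO
  have hCO : ∀ n, C ⊆ O n := fun n => Metric.self_subset_thickening (by positivity) C
  refine h𝓕.measurableSet_congr (B := ⋂ n, ({ω | X t ω ∈ O n} ∪
    ⋃ (q : ℚ≥0) (_ : (q : ℝ≥0) < t), {ω | X q ω ∈ O n})) ?_ ?_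
  · have hnull := measure_eq_zero_iff_ae_notMem.1
      (hX.measure_approach_without_hitting h𝓕 hC t)
    filter_upwards [hX.ae_isRegularPath, hnull] with ω hω hbad
    refine propext ?_
    change hittingAfter X C 0 ω ≤ t ↔ ω ∈ ⋂ n, ({ω | X t ω ∈ O n} ∪
      ⋃ (q : ℚ≥0) (_ : (q : ℝ≥0) < t), {ω | X q ω ∈ O n})
    simp only [Set.mem_iInter, Set.mem_union, Set.mem_iUnion, Set.mem_ofPred_eq, exists_prop]
    constructor
    · intro h n
      have hne : hittingAfter X C 0 ω ≠ ⊤ := ne_top_of_le_ne_top WithTop.coe_ne_top h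
      have hmem := hC.closure_eq ▸ hittingAfter_mem_closure hω.right_cont hne
      have hle : (hittingAfter X C 0 ω).untopD 0 ≤ t := by
        rw [← WithTop.coe_le_coe, coe_untopD hne]
        exact h
      rcases hle.eq_or_lt with he | hlt
      · exact Or.inl (he ▸ hCO n hmem)
      · obtain ⟨q, -, hq, hqO⟩ := exists_nnrat_of_right_cont (hω.right_cont _) hlt
          Metric.isOpen_thickening (hCO n hmem)
        exact Or.inr ⟨q, hq, hqO⟩
    · intro h
      by_contra hc
      refine hbad ⟨fun n => ?_, fun s hs hsC => hc ?_⟩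
      · rcases h n with h1 | ⟨q, hq, hqO⟩
        · exact hittingAfter_le_of_mem (zero_le (a := t)) h1
        · exact (hittingAfter_le_of_mem (zero_le (a := (q : ℝ≥0))) hqO).trans
            (WithTop.coe_le_coe.2 hq.le)
      · exact (hittingAfter_le_of_mem (zero_le (a := s)) hsC).trans (WithTop.coe_le_coe.2 hs)
  · refine MeasurableSet.iInter fun n => MeasurableSet.union ?_ ?_
    · exact hX.adapted t Metric.isOpen_thickening.measurableSet
    · refine MeasurableSet.iUnion fun q => MeasurableSet.iUnion fun hq => ?_
      exact hX.measurable_of_le hq.le Metric.isOpen_thickening.measurableSet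

end IsLevyProcess

end

/-! ### The candidate value function -/

section

variable {Ω : Type*} {mΩ : MeasurableSpace Ω} {P : Measure Ω}
  {𝓕 : Filtration ℝ≥0 mΩ} {X : ℝ≥0 → Ω → ℝ}

/-- Duality between the supremum of `X` and the infimum of `-X`. -/
lemma runSup_startedAt (X : ℝ≥0 → Ω → ℝ) (x : ℝ) (p : Ω × ℝ) :
    runSup (startedAt X x) p = -runInf (startedAt (fun t ω => -X t ω) (-x)) p := by
  rw [runSup, runInf, Real.sInf_def, neg_neg, ← Set.image_neg_eq_neg, Set.image_image]
  congr 1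
  refine Set.image_congr fun t _ => ?_
  simp only [startedAt]
  ring

lemma meanInf_anti (P : Measure Ω) (X : ℝ≥0 → Ω → ℝ) (r : ℝ) {φ : ℝ → ℝ≥0∞} (hφ : Antitone φ) :
    Antitone (meanInf P X r φ) := fun _ _ hxy =>
  lintegral_mono fun _ => lintegral_mono fun _ => hφ (add_le_add_left hxy _)

lemma expectPayoff_eq_setLIntegral (P : Measure Ω) (X : ℝ≥0 → Ω → ℝ) (r : ℝ) (g : ℝ → ℝ) (x : ℝ)
    {τ : Ω → WithTop ℝ≥0} (hτ : MeasurableSet {ω | τ ω ≠ ⊤}) :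
    expectPayoff P X r g x τ =
      ∫⁻ ω in {ω | τ ω ≠ ⊤}, ENNReal.ofReal (Real.exp (-r * (τ ω).untopD 0)) *
        ENNReal.ofReal (g (x + X ((τ ω).untopD 0) ω)) ∂P := by
  rw [expectPayoff, ← lintegral_indicator hτ]
  refine lintegral_congr fun ω => ?_
  rw [payoff]
  by_cases h : τ ω = ⊤
  · rw [if_pos h, Set.indicator_of_notMem (show ω ∉ {ω | τ ω ≠ ⊤} from fun hω => hω h),
      ENNReal.ofReal_zero]
  · rw [if_neg h, Set.indicator_of_mem (show ω ∈ {ω | τ ω ≠ ⊤} from h),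
      ENNReal.ofReal_mul (Real.exp_pos _).le]
    rfl

namespace IsLevyProcess

lemma expectInf_eq_meanInf [SFinite P] (hX : IsLevyProcess P 𝓕 X) {r : ℝ} (hr : 0 < r) {Q : ℝ → ℝ}
    (hQ : Continuous Q) (x : ℝ) :
    expectInf P X r Q x = meanInf P X r (fun y => ENNReal.ofReal (Q y)) x :=
  hX.lintegral_runInf_eq_meanInf hr (φ := fun y => ENNReal.ofReal (Q y))
    hQ.measurable.ennreal_ofReal x

lemma expectSup_eq_meanInf [SFinite P] (hX : IsLevyProcess P 𝓕 X) {r : ℝ} (hr : 0 < r) {Q : ℝ → ℝ}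
    (hQ : Continuous Q) (x : ℝ) :
    expectSup P X r Q x =
      meanInf P (fun t ω => -X t ω) r (fun y => ENNReal.ofReal (Q (-y))) (-x) := by
  rw [← hX.neg.lintegral_runInf_eq_meanInf hr
    (φ := fun y => ENNReal.ofReal (Q (-y))) (hQ.comp continuous_neg).measurable.ennreal_ofReal]
  refine lintegral_congr fun p => ?_
  simp only [runSup_startedAt]

lemma candidate_eq_add [SFinite P] (hX : IsLevyProcess P 𝓕 X) {r : ℝ} (hr : 0 < r) {Q₁ Q₂ : ℝ → ℝ}
    (hQ₁ : Continuous Q₁) (h₁ : ∀ y, 0 ≤ Q₁ y) (h₂ : ∀ y, 0 ≤ Q₂ y) (x : ℝ) :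
    candidate P X r Q₁ Q₂ x = expectInf P X r Q₁ x + expectSup P X r Q₂ x := by
  rw [expectInf, expectSup, candidate, expectExp, expectExp, expectExp, ← lintegral_add_left'
    (hX.aemeasurable_runInf hr (φ := fun y => ENNReal.ofReal (Q₁ y))
      hQ₁.measurable.ennreal_ofReal x)]
  exact lintegral_congr fun p => ENNReal.ofReal_add (h₁ _) (h₂ _)

lemma ae_exitTime_mem_compl (hX : IsLevyProcess P 𝓕 X) (x a b : ℝ) :
    ∀ᵐ ω ∂P, exitTime X x a b ω ≠ ⊤ →
      x + X ((exitTime X x a b ω).untopD 0) ω ∉ Set.Ioo a b := by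
  filter_upwards [hX.ae_isRegularPath] with ω hω hne
  have h := hittingAfter_mem_closure (X := X) (C := (fun y : ℝ => x + y) ⁻¹' (Set.Ioo a b)ᶜ)
    hω.right_cont hne
  rwa [(isOpen_Ioo.isClosed_compl.preimage (by fun_prop)).closure_eq] at h

variable [IsProbabilityMeasure P]

/-- The discounted candidate at time `τ`, split into its infimum part and its supremum part, the
latter written as an infimum part for `-X`. -/
lemma setLIntegral_discounted_add (hX : IsLevyProcess P 𝓕 X) {τ : Ω → WithTop ℝ≥0}
    (hτ : IsOptionalTime 𝓕 τ) {r : ℝ} (hr : 0 < r) {Q₁ Q₂ : ℝ → ℝ}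
    (hQ₁ : Continuous Q₁) (hQ₂ : Continuous Q₂) (x : ℝ) :
    ∫⁻ ω in {ω | τ ω ≠ ⊤}, ENNReal.ofReal (Real.exp (-r * (τ ω).untopD 0)) *
      (expectInf P X r Q₁ (x + X ((τ ω).untopD 0) ω) +
        expectSup P X r Q₂ (x + X ((τ ω).untopD 0) ω)) ∂P =
    ∫⁻ ω in {ω | τ ω ≠ ⊤}, ENNReal.ofReal (Real.exp (-r * (τ ω).untopD 0)) *
        meanInf P X r (fun y => ENNReal.ofReal (Q₁ y)) (x + X ((τ ω).untopD 0) ω) ∂P +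
      ∫⁻ ω in {ω | τ ω ≠ ⊤}, ENNReal.ofReal (Real.exp (-r * (τ ω).untopD 0)) *
        meanInf P (fun t ω => -X t ω) r (fun y => ENNReal.ofReal (Q₂ (-y)))
          (-x + -X ((τ ω).untopD 0) ω) ∂P := by
  rw [← lintegral_add_left' (hX.aemeasurable_discounted_meanInf hτ hr
    hQ₁.measurable.ennreal_ofReal x).restrict]
  refine lintegral_congr fun ω => ?_
  rw [hX.expectInf_eq_meanInf hr hQ₁, hX.expectSup_eq_meanInf hr hQ₂, mul_add, neg_add]

/-- No optional time yields more than the candidate, if the candidate dominates the payoff. -/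
lemma expectPayoff_le_candidate (hX : IsLevyProcess P 𝓕 X) {r : ℝ} (hr : 0 < r) {g Q₁ Q₂ : ℝ → ℝ}
    (hQ₁ : Continuous Q₁) (hQ₁_anti : Antitone Q₁) (h₁ : ∀ y, 0 ≤ Q₁ y)
    (hQ₂ : Continuous Q₂) (hQ₂_mono : Monotone Q₂) (h₂ : ∀ y, 0 ≤ Q₂ y)
    (hg : ∀ y, ENNReal.ofReal (g y) ≤ candidate P X r Q₁ Q₂ y)
    {τ : Ω → WithTop ℝ≥0} (hτ : IsOptionalTime 𝓕 τ) (x : ℝ) :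
    expectPayoff P X r g x τ ≤ candidate P X r Q₁ Q₂ x := by
  have hle : ∀ y, ENNReal.ofReal (g y) ≤ expectInf P X r Q₁ y + expectSup P X r Q₂ y := fun y =>
    (hg y).trans (hX.candidate_eq_add hr hQ₁ h₁ h₂ y).le
  rw [expectPayoff_eq_setLIntegral P X r g x hτ.measurableSet_ne_top,
    hX.candidate_eq_add hr hQ₁ h₁ h₂, hX.expectInf_eq_meanInf hr hQ₁,
    hX.expectSup_eq_meanInf hr hQ₂]
  refine (lintegral_mono fun ω => mul_le_mul_right (hle _) _).trans ?_
  rw [hX.setLIntegral_discounted_add hτ hr hQ₁ hQ₂]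
  exact add_le_add
    (hX.setLIntegral_discounted_meanInf_le hτ hr (ENNReal.continuous_ofReal.comp hQ₁)
      (fun y z h => ENNReal.ofReal_le_ofReal (hQ₁_anti h)) x)
    (hX.neg.setLIntegral_discounted_meanInf_le hτ hr
      (ENNReal.continuous_ofReal.comp (hQ₂.comp continuous_neg))
      (fun y z h => ENNReal.ofReal_le_ofReal (hQ₂_mono (neg_le_neg h))) (-x))

lemma isStoppingTime_exitTime (hX : IsLevyProcess P 𝓕 X) (h𝓕 : IsCompleteFiltration P 𝓕)
    (x a b : ℝ) : IsStoppingTime 𝓕 (exitTime X x a b) :=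
  hX.isStoppingTime_hittingAfter h𝓕 (C := (fun y : ℝ => x + y) ⁻¹' (Set.Ioo a b)ᶜ)
    (isOpen_Ioo.isClosed_compl.preimage (by fun_prop))

/-- The exit time from `(a, b)` attains the candidate. -/
lemma expectPayoff_exitTime_eq_candidate (hX : IsLevyProcess P 𝓕 X)
    (h𝓕 : IsCompleteFiltration P 𝓕) {r : ℝ} (hr : 0 < r) {g Q₁ Q₂ : ℝ → ℝ} {a b : ℝ}
    (hQ₁ : Continuous Q₁) (h₁ : ∀ y, 0 ≤ Q₁ y) (hQ₁_zero : ∀ y, a ≤ y → Q₁ y = 0)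
    (hQ₂ : Continuous Q₂) (h₂ : ∀ y, 0 ≤ Q₂ y) (hQ₂_zero : ∀ y, y ≤ b → Q₂ y = 0)
    (hg : ∀ y, y ∉ Set.Ioo a b →
      ENNReal.ofReal (g y) = expectInf P X r Q₁ y + expectSup P X r Q₂ y) (x : ℝ) :
    expectPayoff P X r g x (exitTime X x a b) = candidate P X r Q₁ Q₂ x := by
  have hτ := (hX.isStoppingTime_exitTime h𝓕 x a b).isOptionalTime
  set τ := exitTime X x a b with hτ_def
  have hbefore : ∀ ω (t : ℝ≥0), t < τ ω → x + X t ω ∈ Set.Ioo a b := fun ω t ht =>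
    not_not.1 (notMem_of_lt_hittingAfter ht (zero_le (a := t)))
  have hexit : ∀ᵐ ω ∂P, ω ∈ {ω | τ ω ≠ ⊤} →
      ENNReal.ofReal (Real.exp (-r * (τ ω).untopD 0)) *
        ENNReal.ofReal (g (x + X ((τ ω).untopD 0) ω)) =
      ENNReal.ofReal (Real.exp (-r * (τ ω).untopD 0)) *
        (expectInf P X r Q₁ (x + X ((τ ω).untopD 0) ω) +
          expectSup P X r Q₂ (x + X ((τ ω).untopD 0) ω)) := by
    filter_upwards [hX.ae_exitTime_mem_compl x a b] with ω hω hne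
    rw [hg _ (hω hne)]
  rw [expectPayoff_eq_setLIntegral P X r g x hτ.measurableSet_ne_top,
    hX.candidate_eq_add hr hQ₁ h₁ h₂, hX.expectInf_eq_meanInf hr hQ₁,
    hX.expectSup_eq_meanInf hr hQ₂, setLIntegral_congr_fun_ae hτ.measurableSet_ne_top hexit,
    hX.setLIntegral_discounted_add hτ hr hQ₁ hQ₂,
    hX.setLIntegral_discounted_meanInf_eq hτ hr
      (φ := fun y => ENNReal.ofReal (Q₁ y)) (ENNReal.continuous_ofReal.comp hQ₁) (a := a)
      (fun y hy => by simp [hQ₁_zero y hy])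
      (Eventually.of_forall fun ω t ht => (hbefore ω t ht).1.le),
    hX.neg.setLIntegral_discounted_meanInf_eq hτ hr (φ := fun y => ENNReal.ofReal (Q₂ (-y)))
      (ENNReal.continuous_ofReal.comp (hQ₂.comp continuous_neg)) (a := -b)
      (fun y hy => by simp [hQ₂_zero (-y) (by linarith)])
      (Eventually.of_forall fun ω t ht => by linarith [(hbefore ω t ht).2])]

/-- Outside `(a, b)` the two terms of the candidate are finite because `g` is; inside they are
dominated by their values at `a` and at `b` respectively. -/
lemma candidate_lt_top (hX : IsLevyProcess P 𝓕 X) {r : ℝ} (hr : 0 < r) {g Q₁ Q₂ : ℝ → ℝ} {a b : ℝ}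
    (hQ₁ : Continuous Q₁) (hQ₁_anti : Antitone Q₁) (h₁ : ∀ y, 0 ≤ Q₁ y)
    (hQ₂ : Continuous Q₂) (hQ₂_mono : Monotone Q₂) (h₂ : ∀ y, 0 ≤ Q₂ y)
    (hg : ∀ y, y ∉ Set.Ioo a b →
      ENNReal.ofReal (g y) = expectInf P X r Q₁ y + expectSup P X r Q₂ y) (x : ℝ) :
    candidate P X r Q₁ Q₂ x < ⊤ := by
  rw [hX.candidate_eq_add hr hQ₁ h₁ h₂]
  refine ENNReal.add_lt_top.2 ⟨?_, ?_⟩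
  · rw [hX.expectInf_eq_meanInf hr hQ₁]
    refine (meanInf_anti P X r (fun y z h => ENNReal.ofReal_le_ofReal (hQ₁_anti h))
      (min_le_left x a)).trans_lt ?_
    rw [← hX.expectInf_eq_meanInf hr hQ₁]
    refine lt_of_le_of_lt le_self_add ((hg (min x a) fun h => ?_).symm.trans_lt
      ENNReal.ofReal_lt_top)
    exact absurd (min_le_right x a) (not_le.2 h.1)
  · rw [hX.expectSup_eq_meanInf hr hQ₂]
    refine (meanInf_anti P _ r (fun y z h => ENNReal.ofReal_le_ofReal (hQ₂_mono (neg_le_neg h)))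
      (neg_le_neg (le_max_left x b))).trans_lt ?_
    rw [← hX.expectSup_eq_meanInf hr hQ₂]
    refine lt_of_le_of_lt le_add_self ((hg (max x b) fun h => ?_).symm.trans_lt
      ENNReal.ofReal_lt_top)
    exact absurd (le_max_right x b) (not_le.2 h.2)

end IsLevyProcess

end

end TwoSidedStopping

end

theorem theorem1 {Ω : Type*} {mΩ : MeasurableSpace Ω} (P : Measure Ω) [IsProbabilityMeasure P]
    (𝓕 : Filtration ℝ≥0 mΩ) (h𝓕 : TwoSidedStopping.IsCompleteFiltration P 𝓕)
    (X : ℝ≥0 → Ω → ℝ) (hX : TwoSidedStopping.IsLevyProcess P 𝓕 X)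
    (r : ℝ) (hr : 0 < r)
    (g : ℝ → ℝ) (hg : Continuous g) (hg0 : ∀ x, 0 ≤ g x)
    (x₁ x₂ : ℝ) (hx₁ : -x₁ < 0) (hx₂ : 0 < x₂)
    (Q₁ Q₂ : ℝ → ℝ)
    (hQ₁ : Continuous Q₁) (hQ₁_anti : Antitone Q₁) (hQ₁_zero : ∀ x, -x₁ ≤ x → Q₁ x = 0)
    (hQ₂ : Continuous Q₂) (hQ₂_mono : Monotone Q₂) (hQ₂_zero : ∀ x, x ≤ x₂ → Q₂ x = 0)
    (hgQ : ∀ x, x ∉ Set.Ioo (-x₁) x₂ →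
      ENNReal.ofReal (g x) =
        TwoSidedStopping.expectInf P X r Q₁ x + TwoSidedStopping.expectSup P X r Q₂ x)
    (hVg : ∀ x, x ∈ Set.Icc (-x₁) x₂ →
      ENNReal.ofReal (g x) ≤ TwoSidedStopping.candidate P X r Q₁ Q₂ x) :
    ∀ x : ℝ,
      TwoSidedStopping.candidate P X r Q₁ Q₂ x < ⊤ ∧
      TwoSidedStopping.valueFunction P 𝓕 X r g x =
        TwoSidedStopping.candidate P X r Q₁ Q₂ x ∧
      IsStoppingTime 𝓕 (TwoSidedStopping.exitTime X x (-x₁) x₂) ∧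
      TwoSidedStopping.expectPayoff P X r g x (TwoSidedStopping.exitTime X x (-x₁) x₂) =
        TwoSidedStopping.valueFunction P 𝓕 X r g x := by
  intro x
  have h₁ : ∀ y, 0 ≤ Q₁ y := fun y => by
    rw [← hQ₁_zero (max y (-x₁)) (le_max_right _ _)]
    exact hQ₁_anti (le_max_left _ _)
  have h₂ : ∀ y, 0 ≤ Q₂ y := fun y => by
    rw [← hQ₂_zero (min y x₂) (min_le_right _ _)]
    exact hQ₂_mono (min_le_left _ _)
  have hgV : ∀ y, ENNReal.ofReal (g y) ≤ TwoSidedStopping.candidate P X r Q₁ Q₂ y := fun y => by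
    by_cases hy : y ∈ Set.Ioo (-x₁) x₂
    · exact hVg y ⟨hy.1.le, hy.2.le⟩
    · exact ((hgQ y hy).trans (hX.candidate_eq_add hr hQ₁ h₁ h₂ y).symm).le
  have h_exit := hX.isStoppingTime_exitTime h𝓕 x (-x₁) x₂
  have hopt := hX.expectPayoff_exitTime_eq_candidate h𝓕 hr hQ₁ h₁ hQ₁_zero hQ₂ h₂ hQ₂_zero hgQ x
  have hval : TwoSidedStopping.valueFunction P 𝓕 X r g x =
      TwoSidedStopping.candidate P X r Q₁ Q₂ x := by
    refine le_antisymm (iSup_le fun τ => ?_) ?_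
    · exact hX.expectPayoff_le_candidate hr hQ₁ hQ₁_anti h₁ hQ₂ hQ₂_mono h₂ hgV
        τ.2.isOptionalTime x
    · rw [← hopt]
      exact le_iSup (fun τ : {τ : Ω → WithTop ℝ≥0 // IsStoppingTime 𝓕 τ} =>
        TwoSidedStopping.expectPayoff P X r g x τ.1) ⟨_, h_exit⟩
  exact ⟨hX.candidate_lt_top hr hQ₁ hQ₁_anti h₁ hQ₂ hQ₂_mono h₂ hgQ x, hval, h_exit,
    hopt.trans hval.symm⟩
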